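/- Let $(\mathbb B,\|\cdot\|)$ be a separable real Banach space. For $1<r\le 2$, call $\mathbb B$ \emph{$r$-smooth} if there is an equivalent norm $\|\cdot\|'$ on $\mathbb B$ such that $$\sup_{t>0}\ \sup_{\|x\|'=\|y\|'=1}\frac{\|x+ty\|'+\|x-ty\|'-2}{t^r}<\infty .$$ For integers $n\ge m\ge 1$ let $\operatorname{Inc}_n^m$ be the set of $\boldsymbol i=(i_1,\dots,i_m)$ with $1\le i_1<\dots<i_m\le n$. For a sequence $(\xi_i)_{i\ge1}$ write $\xi_{\boldsymbol i}=(\xi_{i_1},\dots,\xi_{i_m})$ and, for $J\subseteq\{1,\dots,m\}$, $\xi_J=(\xi_j)_{j\in J}$ and $[m]=\{1,\dots,m\}$. For all $m\ge1$, $p>1$ and $q>0$ there is a constant $K=K(m,p,q,\mathbb B)\in(0,\infty)$, depending only on $m,p,q$ and $\mathbb B$, such that the following holds. Suppose that $\mathbb B$ is $r$-smooth for some $r\in(1,2]$ with $p\le r$. Let $(\xi_i)_{i\ge1}$ be an i.i.d. sequence of random variables with values in a measurable space $(S,\mathcal S)$, and let $h\colon S^m\to\mathbb B$ be a measurable function that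 is degenerated with respect to $(\xi_i)_{i\ge1}$, that is, $h(\xi_{[m]})$ is integrable and, for each $\ell_0\in[m]$, $$\mathbb E\big[h(\xi_{[m]})\mid \xi_{[m]\setminus\{\ell_0\}}\big]=0\quad\text{almost surely.}$$ Then for every $t>0$ and every integer $N\ge m$, $$\begin{aligned} \mathbb P\Big(\max_{m\le n\le N}\Big\|\sum_{\boldsymbol i\in\operatorname{Inc}_n^m}h(\xi_{\boldsymbol i})\Big\|>t\Big) \le{}& K\,N^m\int_0^1u^{q-1}\,\mathbb P\big(\|h(\xi_{[m]})\|>tu\big)\,du\\ &+K\sum_{\emptyset\subsetneq J\subsetneq[m]}N^{|J|}\int_0^1u^{q-1}\,\mathbb P\Big(N^{\frac{m-|J|}{p}}\big(\mathbb E\big[\|h(\xi_{[m]})\|^p\mid\xi_J\big]\big)^{1/p}>tu\Big)\,du\\ &+K\,t^{-q}N^{mq/p}\big(\mathbb E\|h(\xi_{[m]})\|^p\big)^{q/p}, \end{aligned}$$ where both sides are read in $[0,\infty]$ (the last term is $+\infty$ if $\mathbb E\|h(\xi_{[m]})\|^p=\infty$). -/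

import Mathlib

open MeasureTheory ProbabilityTheory
open scoped ENNReal NNReal

noncomputable section

/-- A real normed space is `r`-smooth if it carries an equivalent norm `ν` with
`sup_{t > 0} sup_{ν x = ν y = 1} (ν (x + t y) + ν (x - t y) - 2) / t ^ r < ∞`.
(A seminorm that is equivalent to the given norm is automatically a norm.) -/
def IsRSmooth (r : ℝ) (B : Type*) [NormedAddCommGroup B] [NormedSpace ℝ B] : Prop :=
  ∃ ν : Seminorm ℝ B,
    (∃ c C : ℝ, 0 < c ∧ 0 < C ∧ ∀ x : B, c * ‖x‖ ≤ ν x ∧ ν x ≤ C * ‖x‖) ∧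
    ∃ M : ℝ, ∀ t : ℝ, 0 < t → ∀ x y : B, ν x = 1 → ν y = 1 →
      (ν (x + t • y) + ν (x - t • y) - 2) / t ^ r ≤ M

/-- `ξ` is an i.i.d. sequence of `S`-valued random variables under `P`. -/
structure IsIID {Ω S : Type*} [MeasurableSpace Ω] [MeasurableSpace S]
    (P : Measure Ω) (ξ : ℕ → Ω → S) : Prop where
  measurable : ∀ i, Measurable (ξ i)
  indep : iIndepFun ξ P
  identDistrib : ∀ i, IdentDistrib (ξ i) (ξ 0) P P

/-- The random vector made of the first `m` terms of the sequence. Sequences are indexed from `0`,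
so the positions `0, …, m - 1` (the elements of `Fin m`) play the role of `1, …, m`. -/
def firstVars {Ω S : Type*} (m : ℕ) (ξ : ℕ → Ω → S) (ω : Ω) : Fin m → S :=
  fun l => ξ l ω

/-- The σ-algebra on `Ω` generated by the random vector `ξ_J = (ξ_j)_{j ∈ J}`. -/
abbrev sigmaOf {Ω S : Type*} [MeasurableSpace S] {m : ℕ} (ξ : ℕ → Ω → S) (J : Finset (Fin m)) :
    MeasurableSpace Ω :=
  MeasurableSpace.comap (fun (ω : Ω) (j : J) => ξ (j : Fin m) ω) MeasurableSpace.pi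

/-- The kernel `h` is degenerated with respect to `ξ`: the random variable `h (ξ_1, …, ξ_m)` is
integrable and its conditional expectation given all of `ξ_1, …, ξ_m` but any one is zero. -/
def IsDegenerated {Ω S B : Type*} [MeasurableSpace Ω] [MeasurableSpace S]
    [NormedAddCommGroup B] [NormedSpace ℝ B] [CompleteSpace B] {m : ℕ}
    (P : Measure Ω) (ξ : ℕ → Ω → S) (h : (Fin m → S) → B) : Prop :=
  Integrable (fun ω => h (firstVars m ξ ω)) P ∧
    ∀ l : Fin m, P[fun ω => h (firstVars m ξ ω) | sigmaOf ξ (Finset.univ \ {l})] =ᵐ[P] 0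

/-- The `U`-statistic of order `m` with kernel `h`: the sum of `h (ξ_{i_1}, …, ξ_{i_m})` over all
strictly increasing `m`-tuples of indices among the first `n`. -/
def uStat {Ω S B : Type*} [AddCommMonoid B] {m : ℕ}
    (ξ : ℕ → Ω → S) (h : (Fin m → S) → B) (n : ℕ) (ω : Ω) : B :=
  ∑ i : Fin m ↪o Fin n, h (fun l => ξ (i l) ω)

/-- `∫₀¹ u ^ (q - 1) * P (Y > t u) du` for a random variable `Y` with values in `[0, ∞]`. -/
def tailIntegral {Ω : Type*} [MeasurableSpace Ω] (P : Measure Ω) (Y : Ω → ℝ≥0∞) (q t : ℝ) :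
    ℝ≥0∞ :=
  ∫⁻ u in Set.Ioc (0 : ℝ) 1,
    ENNReal.ofReal (u ^ (q - 1)) * P {ω | ENNReal.ofReal (t * u) < Y ω}

end

/-!
Smoothness of the norm yields a gauge `φ` comparable to `‖·‖ ^ p` with a modulus of smoothness of
order `p`, so that partial sums of centred increments have `p`-th moments bounded by the sum of the
moments of the increments. Applied to the increments between the first passages of the levels `t`
and `2 * t`, this bound gives a good-`λ` inequality.

The proof is by induction on the order `m`. The increments of a `U`-statistic of order `m + 1` are
`U`-statistics of order `m` whose kernel has its last variable frozen at the fresh observation, and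
their conditional moments are `L^p` norms of `U`-statistics of order `m` whose last variable has
become a parameter. Kernels therefore take values in `L^p` of an auxiliary parameter space. The
right-hand side of the inequality obeys the matching recursion: a set `J ⊆ [m + 1]` either contains
the last index (frozen variable) or does not (absorbed variable). A good-`λ` inequality with small
enough factor can then be iterated over the dyadic levels `t, t / 2, t / 4, …`.
-/

noncomputable section

/-! ### Smooth gauges -/

/-- A convex substitute `φ` for `‖·‖ ^ p`: it is comparable to `‖·‖ ^ p` and satisfies a
parallelogram-type inequality. In a smooth space, `φ` is the `p`-th power of the smooth norm. -/
structure IsSmoothGauge {B : Type*} [NormedAddCommGroup B] [NormedSpace ℝ B]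
    (p C : ℝ) (φ : B → ℝ) : Prop where
  const_pos : 0 < C
  continuous : Continuous φ
  convexOn : ConvexOn ℝ Set.univ φ
  map_zero : φ 0 = 0
  norm_rpow_le : ∀ x, ‖x‖ ^ p ≤ φ x
  le_norm_rpow : ∀ x, φ x ≤ C * ‖x‖ ^ p
  add_sub_le : ∀ x y, φ (x + y) + φ (x - y) ≤ 2 * φ x + C * ‖y‖ ^ p

lemma one_add_rpow_le_quadratic {p a : ℝ} (hp : 1 ≤ p) (hp2 : p ≤ 2) (ha : -1 ≤ a) :
    (1 + a) ^ p ≤ 1 + p * a + a ^ 2 := by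
  have hbernoulli : (1 + a) ^ (p - 1) ≤ 1 + (p - 1) * a :=
    rpow_one_add_le_one_add_mul_self ha (by linarith) (by linarith)
  calc (1 + a) ^ p = (1 + a) * (1 + a) ^ (p - 1) := by
        rw [← Real.rpow_one_add' (by linarith) (by linarith), add_sub_cancel]
    _ ≤ (1 + a) * (1 + (p - 1) * a) := mul_le_mul_of_nonneg_left hbernoulli (by linarith)
    _ ≤ 1 + p * a + a ^ 2 := by nlinarith [mul_nonneg (by linarith : 0 ≤ 2 - p) (sq_nonneg a)]

lemma rpow_add_rpow_le_of_abs_sub_one_le {p M t a b : ℝ} (hp : 1 ≤ p) (hp2 : p ≤ 2)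
    (ht : 0 ≤ t) (ht1 : t ≤ 1) (ha : |a - 1| ≤ t) (hb : |b - 1| ≤ t)
    (hab : a + b - 2 ≤ M * t ^ p) :
    a ^ p + b ^ p ≤ 2 + (p * M + 2) * t ^ p := by
  have hsq : t ^ 2 ≤ t ^ p := by
    rw [← Real.rpow_natCast]
    exact Real.rpow_le_rpow_of_exponent_ge' ht ht1 (by linarith) (by exact_mod_cast hp2)
  have hlin : ∀ c : ℝ, |c - 1| ≤ t → c ^ p ≤ 1 + p * (c - 1) + t ^ p := fun c hc => by
    have hquad := one_add_rpow_le_quadratic (a := c - 1) hp hp2 (by linarith [(abs_le.1 hc).1])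
    rw [add_sub_cancel] at hquad
    linarith [sq_le_sq' (abs_le.1 hc).1 (abs_le.1 hc).2]
  have hsum : p * (a + b - 2) ≤ p * (M * t ^ p) := mul_le_mul_of_nonneg_left hab (by linarith)
  linarith [hlin a ha, hlin b hb]

section Seminorm

variable {B : Type*} [AddCommGroup B] [Module ℝ B] {ν : Seminorm ℝ B} {p r M : ℝ}

lemma seminorm_rpow_add_rpow_sub_le_of_eq_one (hp : 1 ≤ p) (hpr : p ≤ r) (hr : r ≤ 2)
    (hM : ∀ t : ℝ, 0 < t → ∀ x y : B, ν x = 1 → ν y = 1 →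
      (ν (x + t • y) + ν (x - t • y) - 2) / t ^ r ≤ M)
    {x y : B} (hx : ν x = 1) (hy : ν y ≤ 1) :
    ν (x + y) ^ p + ν (x - y) ^ p ≤ 2 + (p * |M| + 2) * ν y ^ p := by
  have hadd : |ν (x + y) - 1| ≤ ν y := by
    have := map_sub_le_add ν (x + y) y
    rw [add_sub_cancel_right] at this
    rw [abs_le]; constructor <;> linarith [map_add_le_add ν x y]
  have hsub : |ν (x - y) - 1| ≤ ν y := by
    have := map_add_le_add ν (x - y) y
    rw [sub_add_cancel] at this
    rw [abs_le]; constructor <;> linarith [map_sub_le_add ν x y]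
  refine rpow_add_rpow_le_of_abs_sub_one_le hp (hpr.trans hr) (apply_nonneg ν y) hy hadd hsub ?_
  rcases (apply_nonneg ν y).eq_or_lt with hy0 | hy0
  · rw [← hy0, Real.zero_rpow (by linarith)]
    linarith [abs_le.1 hadd, abs_le.1 hsub]
  have hunit : ν ((ν y)⁻¹ • y) = 1 := by
    rw [map_smul_eq_mul, Real.norm_of_nonneg (by positivity), inv_mul_cancel₀ hy0.ne']
  have hsmooth := hM (ν y) hy0 x _ hx hunit
  rw [div_le_iff₀ (by positivity), smul_inv_smul₀ hy0.ne'] at hsmooth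
  calc ν (x + y) + ν (x - y) - 2 ≤ M * ν y ^ r := hsmooth
    _ ≤ |M| * ν y ^ r := by gcongr; exact le_abs_self M
    _ ≤ |M| * ν y ^ p := by gcongr |M| * ?_; exact Real.rpow_le_rpow_of_exponent_ge hy0 hy hpr

lemma seminorm_rpow_add_rpow_sub_le (hp : 1 ≤ p) (hpr : p ≤ r) (hr : r ≤ 2)
    (hM : ∀ t : ℝ, 0 < t → ∀ x y : B, ν x = 1 → ν y = 1 →
      (ν (x + t • y) + ν (x - t • y) - 2) / t ^ r ≤ M) (x y : B) :
    ν (x + y) ^ p + ν (x - y) ^ p ≤ 2 * ν x ^ p + (p * |M| + 8) * ν y ^ p := by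
  have hx0 := apply_nonneg ν x
  have hy0 := apply_nonneg ν y
  have hpM : 0 ≤ p * |M| := by positivity
  have hyp : 0 ≤ ν y ^ p := by positivity
  have hxp : 0 ≤ ν x ^ p := by positivity
  rcases le_or_gt (ν x) (ν y) with hxy | hxy
  · have htwo : (2 * ν y) ^ p ≤ 4 * ν y ^ p := by
      rw [Real.mul_rpow (by norm_num) hy0]
      gcongr
      calc (2 : ℝ) ^ p ≤ 2 ^ (2 : ℝ) :=
            Real.rpow_le_rpow_of_exponent_le (by norm_num) (hpr.trans hr)
        _ = 4 := by norm_num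
    have hadd : ν (x + y) ^ p ≤ (2 * ν y) ^ p :=
      Real.rpow_le_rpow (apply_nonneg _ _) (by linarith [map_add_le_add ν x y]) (by linarith)
    have hsub : ν (x - y) ^ p ≤ (2 * ν y) ^ p :=
      Real.rpow_le_rpow (apply_nonneg _ _) (by linarith [map_sub_le_add ν x y]) (by linarith)
    nlinarith
  · have hx : 0 < ν x := hy0.trans_lt hxy
    have hscale : ∀ z, ν ((ν x)⁻¹ • z) = ν z / ν x := fun z => by
      rw [map_smul_eq_mul, Real.norm_of_nonneg (by positivity), div_eq_inv_mul]
    have hnormalized := seminorm_rpow_add_rpow_sub_le_of_eq_one hp hpr hr hM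
      (x := (ν x)⁻¹ • x) (y := (ν x)⁻¹ • y) (by rw [hscale, div_self hx.ne'])
      (by rw [hscale, div_le_one hx]; exact hxy.le)
    simp only [← smul_add, ← smul_sub, hscale, Real.div_rpow (apply_nonneg ν _) hx0,
      ← add_div, ← mul_div_assoc] at hnormalized
    rw [div_le_iff₀ (by positivity), add_mul, div_mul_cancel₀ _ (by positivity)] at hnormalized
    nlinarith

lemma seminorm_convexOn_rpow (ν : Seminorm ℝ B) (hp : 1 ≤ p) :
    ConvexOn ℝ Set.univ fun x => ν x ^ p := by
  refine ⟨convex_univ, fun x _ y _ a b ha hb hab => ?_⟩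
  calc ν (a • x + b • y) ^ p ≤ (a • ν x + b • ν y) ^ p :=
        Real.rpow_le_rpow (apply_nonneg _ _) (ν.convexOn.2 trivial trivial ha hb hab) (by linarith)
    _ ≤ a • ν x ^ p + b • ν y ^ p :=
        (convexOn_rpow hp).2 (apply_nonneg ν x) (apply_nonneg ν y) ha hb hab

end Seminorm

lemma integrable_norm_rpow_of_memLp {S E : Type*} [MeasurableSpace S] {μ : Measure S}
    [NormedAddCommGroup E] {p : ℝ} (hp : 0 < p) {f : S → E}
    (hf : MemLp f (ENNReal.ofReal p) μ) : Integrable (fun x => ‖f x‖ ^ p) μ := by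
  have h := hf.integrable_norm_rpow (ENNReal.ofReal_pos.2 hp).ne' ENNReal.ofReal_ne_top
  rwa [ENNReal.toReal_ofReal hp.le] at h

section Gauge

variable {B : Type*} [NormedAddCommGroup B] [NormedSpace ℝ B] {p : ℝ}

lemma seminorm_continuous_of_le_mul_norm {ν : Seminorm ℝ B} {C : ℝ} (h : ∀ x, ν x ≤ C * ‖x‖) :
    Continuous ν := by
  have hle : ν ≤ C.toNNReal • normSeminorm ℝ B := fun x => by
    refine (h x).trans ?_
    simpa [NNReal.smul_def] using
      mul_le_mul_of_nonneg_right (le_max_left C 0) (norm_nonneg x)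
  exact Seminorm.continuous_of_le (continuous_norm.const_smul _) hle

lemma IsRSmooth.exists_isSmoothGauge {r : ℝ} (hp : 1 ≤ p) (hpr : p ≤ r) (hr : r ≤ 2)
    (h : IsRSmooth r B) : ∃ (C : ℝ) (φ : B → ℝ), IsSmoothGauge p C φ := by
  obtain ⟨ν, ⟨c, C, hc, hC, hcC⟩, M, hM⟩ := h
  have hp0 : 0 ≤ p := by linarith
  have hA : 0 ≤ (C / c) ^ p := by positivity
  have hpM : 0 ≤ p * |M| := by positivity
  have hdiv : ∀ x, (c ^ p)⁻¹ * ν x ^ p = (ν x / c) ^ p := fun x => by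
    rw [Real.div_rpow (apply_nonneg _ _) hc.le, div_eq_inv_mul]
  have hupper : ∀ x, (c ^ p)⁻¹ * ν x ^ p ≤ (C / c) ^ p * ‖x‖ ^ p := fun x => by
    rw [hdiv, ← Real.mul_rpow (by positivity) (norm_nonneg x), div_mul_eq_mul_div]
    exact Real.rpow_le_rpow (by positivity) (div_le_div_of_nonneg_right (hcC x).2 hc.le) hp0
  refine ⟨(p * |M| + 8) * (C / c) ^ p, fun x => (c ^ p)⁻¹ * ν x ^ p, by positivity, ?_, ?_, ?_,
    fun x => ?_, fun x => ?_, fun x y => ?_⟩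
  · exact ((seminorm_continuous_of_le_mul_norm fun x => (hcC x).2).rpow_const
      fun x => Or.inr hp0).const_mul _
  · exact (seminorm_convexOn_rpow ν hp).smul (by positivity)
  · simp [Real.zero_rpow (by linarith : p ≠ 0)]
  · rw [hdiv]
    refine Real.rpow_le_rpow (norm_nonneg _) ?_ hp0
    rw [le_div_iff₀' hc]
    exact (hcC x).1
  · exact (hupper x).trans (by gcongr; nlinarith)
  · calc (c ^ p)⁻¹ * ν (x + y) ^ p + (c ^ p)⁻¹ * ν (x - y) ^ p
        = (c ^ p)⁻¹ * (ν (x + y) ^ p + ν (x - y) ^ p) := by ring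
      _ ≤ (c ^ p)⁻¹ * (2 * ν x ^ p + (p * |M| + 8) * ν y ^ p) := by
          gcongr ?_ * ?_; exact seminorm_rpow_add_rpow_sub_le hp hpr hr hM x y
      _ = 2 * ((c ^ p)⁻¹ * ν x ^ p) + (p * |M| + 8) * ((c ^ p)⁻¹ * ν y ^ p) := by ring
      _ ≤ 2 * ((c ^ p)⁻¹ * ν x ^ p) + (p * |M| + 8) * ((C / c) ^ p * ‖y‖ ^ p) := by
          gcongr _ + _ * ?_; exact hupper y
      _ = _ := by ring

variable {C : ℝ} {φ : B → ℝ}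

lemma IsSmoothGauge.nonneg (hφ : IsSmoothGauge p C φ) (x : B) : 0 ≤ φ x :=
  (Real.rpow_nonneg (norm_nonneg x) p).trans (hφ.norm_rpow_le x)

variable {S : Type*} [MeasurableSpace S] {μ : Measure S}

lemma IsSmoothGauge.integrable_comp (hφ : IsSmoothGauge p C φ) (hp : 1 ≤ p) {f : S → B}
    (hf : MemLp f (ENNReal.ofReal p) μ) : Integrable (fun x => φ (f x)) μ := by
  refine ((integrable_norm_rpow_of_memLp (by linarith) hf).const_mul C).mono'
    (hφ.continuous.comp_aestronglyMeasurable hf.1) (ae_of_all _ fun x => ?_)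
  rw [Real.norm_of_nonneg (hφ.nonneg _)]
  exact hφ.le_norm_rpow _

variable [CompleteSpace B] [IsProbabilityMeasure μ] {g : S → B}

lemma IsSmoothGauge.integral_add_le (hφ : IsSmoothGauge p C φ) (hp : 1 ≤ p)
    (hg : MemLp g (ENNReal.ofReal p) μ) (hg0 : ∫ x, g x ∂μ = 0) (s : B) :
    ∫ x, φ (s + g x) ∂μ ≤ φ s + C * ∫ x, ‖g x‖ ^ p ∂μ := by
  have hgi : Integrable g μ := hg.integrable (by simpa using hp)
  have hadd : Integrable (fun x => φ (s + g x)) μ :=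
    hφ.integrable_comp hp ((memLp_const s).add hg)
  have hsub : Integrable (fun x => φ (s - g x)) μ :=
    hφ.integrable_comp hp ((memLp_const s).sub hg)
  have hpow := (integrable_norm_rpow_of_memLp (by linarith) hg).const_mul C
  have hjensen : φ s ≤ ∫ x, φ (s - g x) ∂μ := by
    have h := hφ.convexOn.map_integral_le hφ.continuous.continuousOn isClosed_univ
      (ae_of_all _ fun _ => trivial) ((integrable_const s).sub hgi) hsub
    simpa [integral_sub (integrable_const s) hgi, hg0] using h
  have hparallelogram : ∫ x, φ (s + g x) ∂μ + ∫ x, φ (s - g x) ∂μ ≤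
      2 * φ s + C * ∫ x, ‖g x‖ ^ p ∂μ := by
    calc ∫ x, φ (s + g x) ∂μ + ∫ x, φ (s - g x) ∂μ
        = ∫ x, (φ (s + g x) + φ (s - g x)) ∂μ := (integral_add hadd hsub).symm
      _ ≤ ∫ x, (2 * φ s + C * ‖g x‖ ^ p) ∂μ :=
          integral_mono (hadd.add hsub) ((integrable_const _).add hpow)
            fun x => hφ.add_sub_le s (g x)
      _ = 2 * φ s + C * ∫ x, ‖g x‖ ^ p ∂μ := by
          rw [integral_add (integrable_const _) hpow, integral_const, probReal_univ, one_smul,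
            integral_const_mul]
  linarith

lemma IsSmoothGauge.lintegral_add_le (hφ : IsSmoothGauge p C φ) (hp : 1 ≤ p)
    (hg : AEStronglyMeasurable g μ) (hg0 : ∫ x, g x ∂μ = 0) (s : B) :
    ∫⁻ x, ENNReal.ofReal (φ (s + g x)) ∂μ ≤
      ENNReal.ofReal (φ s) + ENNReal.ofReal C * ∫⁻ x, ‖g x‖ₑ ^ p ∂μ := by
  have hC := hφ.const_pos
  by_cases htop : ∫⁻ x, ‖g x‖ₑ ^ p ∂μ = ∞
  · simp [htop, ENNReal.mul_top, hC]
  have hmem : MemLp g (ENNReal.ofReal p) μ := by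
    refine ⟨hg, ?_⟩
    rw [eLpNorm_lt_top_iff_lintegral_rpow_enorm_lt_top (ENNReal.ofReal_pos.2 (by linarith)).ne'
      ENNReal.ofReal_ne_top, ENNReal.toReal_ofReal (by linarith)]
    exact lt_top_iff_ne_top.2 htop
  have hpow : ∫⁻ x, ‖g x‖ₑ ^ p ∂μ = ENNReal.ofReal (∫ x, ‖g x‖ ^ p ∂μ) := by
    rw [ofReal_integral_eq_lintegral_ofReal (integrable_norm_rpow_of_memLp (by linarith) hmem)
      (ae_of_all _ fun x => by positivity)]
    exact lintegral_congr fun x => by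
      rw [← ofReal_norm, ENNReal.ofReal_rpow_of_nonneg (norm_nonneg _) (by linarith)]
  have hadd : Integrable (fun x => φ (s + g x)) μ :=
    hφ.integrable_comp hp ((memLp_const s).add hmem)
  rw [← ofReal_integral_eq_lintegral_ofReal hadd (ae_of_all _ fun x => hφ.nonneg _), hpow,
    ← ENNReal.ofReal_mul hC.le, ← ENNReal.ofReal_add (hφ.nonneg _) (by positivity)]
  exact ENNReal.ofReal_le_ofReal (hφ.integral_add_le hp hmem hg0 s)

end Gauge

/-! ### The past of an i.i.d. sequence -/

lemma lintegral_indepFun {Ω S Y : Type*} {mΩ : MeasurableSpace Ω} {mS : MeasurableSpace S}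
    {mY : MeasurableSpace Y} {P : Measure Ω} [IsProbabilityMeasure P]
    {Z : Ω → Y} {X : Ω → S} (hZ : Measurable Z) (hX : Measurable X) (hind : IndepFun Z X P)
    {G : Y → S → ℝ≥0∞} (hG : Measurable (Function.uncurry G)) :
    ∫⁻ ω, G (Z ω) (X ω) ∂P = ∫⁻ ω, ∫⁻ x, G (Z ω) x ∂(P.map X) ∂P := by
  have : IsProbabilityMeasure (P.map X) := Measure.isProbabilityMeasure_map hX.aemeasurable
  have hmap := (indepFun_iff_map_prod_eq_prod_map_map hZ.aemeasurable hX.aemeasurable).1 hind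
  calc ∫⁻ ω, Function.uncurry G (Z ω, X ω) ∂P
      = ∫⁻ z, Function.uncurry G z ∂(P.map fun ω => (Z ω, X ω)) :=
        (lintegral_map hG (hZ.prodMk hX)).symm
    _ = ∫⁻ ω, ∫⁻ x, Function.uncurry G (Z ω, x) ∂(P.map X) ∂P := by
        rw [hmap, lintegral_prod _ hG.aemeasurable,
          lintegral_map (Measurable.lintegral_prod_right' hG) hZ]

lemma lintegral_indep {Ω S : Type*} {ℱ mΩ : MeasurableSpace Ω} {mS : MeasurableSpace S}
    {P : Measure Ω} [IsProbabilityMeasure P] (hℱ : ℱ ≤ mΩ) {X : Ω → S} (hX : Measurable X)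
    (hind : Indep ℱ (MeasurableSpace.comap X mS) P) {G : Ω → S → ℝ≥0∞}
    (hG : Measurable[ℱ.prod mS] (Function.uncurry G)) :
    ∫⁻ ω, G ω (X ω) ∂P = ∫⁻ ω, ∫⁻ x, G ω x ∂(P.map X) ∂P := by
  refine @lintegral_indepFun Ω S Ω mΩ mS ℱ P _ id X (measurable_id'' hℱ) hX ?_ G hG
  refine (@IndepFun_iff_Indep Ω Ω S mΩ ℱ mS id X P).2 ?_
  rwa [MeasurableSpace.comap_id]

/-- The σ-algebra generated by the first `k` terms of the sequence. -/
abbrev pastSigma {Ω S : Type*} [MeasurableSpace S] (ξ : ℕ → Ω → S) (k : ℕ) : MeasurableSpace Ω :=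
  ⨆ i ∈ Set.Iio k, MeasurableSpace.comap (ξ i) inferInstance

section Past

variable {Ω S : Type*} [mS : MeasurableSpace S]

lemma measurable_pastSigma (ξ : ℕ → Ω → S) {i k : ℕ} (h : i < k) :
    Measurable[pastSigma ξ k] (ξ i) := by
  rw [measurable_iff_comap_le]
  exact le_iSup₂_of_le (f := fun i (_ : i ∈ Set.Iio k) => MeasurableSpace.comap (ξ i) mS) i h le_rfl

lemma pastSigma_mono (ξ : ℕ → Ω → S) : Monotone (pastSigma ξ) := fun _ _ h =>
  biSup_mono fun _ hi => lt_of_lt_of_le hi h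

variable [mΩ : MeasurableSpace Ω] {P : Measure Ω} {ξ : ℕ → Ω → S}

lemma IsIID.pastSigma_le (hξ : IsIID P ξ) (k : ℕ) : pastSigma ξ k ≤ mΩ :=
  iSup₂_le fun i _ => (hξ.measurable i).comap_le

lemma IsIID.pastSigma_prod_le {α : Type*} [mα : MeasurableSpace α] (hξ : IsIID P ξ) (k : ℕ) :
    (pastSigma ξ k).prod mα ≤ mΩ.prod mα :=
  sup_le_sup (MeasurableSpace.comap_mono (hξ.pastSigma_le k)) le_rfl

lemma IsIID.indep_pastSigma (hξ : IsIID P ξ) (k : ℕ) :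
    Indep (pastSigma ξ k) (MeasurableSpace.comap (ξ k) mS) P := by
  simpa [pastSigma] using indep_iSup_of_disjoint (fun i => (hξ.measurable i).comap_le) hξ.indep
    (S := Set.Iio k) (T := {k}) (by simp)

lemma IsIID.map_eq (hξ : IsIID P ξ) (k : ℕ) : P.map (ξ k) = P.map (ξ 0) :=
  (hξ.identDistrib k).map_eq

lemma IsIID.isProbabilityMeasure_map [IsProbabilityMeasure P] (hξ : IsIID P ξ) :
    IsProbabilityMeasure (P.map (ξ 0)) :=
  Measure.isProbabilityMeasure_map (hξ.measurable 0).aemeasurable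

lemma IsIID.measure_prodMk_mem [IsProbabilityMeasure P] (hξ : IsIID P ξ) {k : ℕ} {A : Set (Ω × S)}
    (hA : MeasurableSet[(pastSigma ξ k).prod mS] A) :
    P {ω | (ω, ξ k ω) ∈ A} = ∫⁻ x, P {ω | (ω, x) ∈ A} ∂(P.map (ξ 0)) := by
  have := hξ.isProbabilityMeasure_map
  have hA' : MeasurableSet A := hξ.pastSigma_prod_le k _ hA
  calc P {ω | (ω, ξ k ω) ∈ A} = ∫⁻ ω, A.indicator 1 (ω, ξ k ω) ∂P :=
        (lintegral_indicator_one (measurable_id.prodMk (hξ.measurable k) hA')).symm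
    _ = ∫⁻ ω, ∫⁻ x, A.indicator 1 (ω, x) ∂(P.map (ξ 0)) ∂P := by
        rw [← hξ.map_eq k]
        exact lintegral_indep (hξ.pastSigma_le k) (hξ.measurable k) (hξ.indep_pastSigma k)
          (G := fun ω x => A.indicator 1 (ω, x))
          ((@measurable_one ℝ≥0∞ _ _ ((pastSigma ξ k).prod mS) _).indicator hA)
    _ = ∫⁻ x, ∫⁻ ω, A.indicator 1 (ω, x) ∂P ∂(P.map (ξ 0)) :=
        lintegral_lintegral_swap (measurable_one.indicator hA').aemeasurable
    _ = ∫⁻ x, P {ω | (ω, x) ∈ A} ∂(P.map (ξ 0)) :=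
        lintegral_congr fun _ => lintegral_indicator_one (measurable_prodMk_right hA')

end Past

/-! ### Moments of sums of predictable increments -/

section Predictable

variable {Ω S T B : Type*} [mS : MeasurableSpace S] [mT : MeasurableSpace T] [MeasurableSpace B]
  {ξ : ℕ → Ω → S}

/-- A family of increments `g k ω x τ` is predictable if the `k`-th one depends on `ω` through the
first `k` variables only. The argument `x` is the place of the fresh variable `ξ k`, and `τ` is an
auxiliary parameter, which will carry the variables that have been integrated out. -/
def DependsOnPast (ξ : ℕ → Ω → S) (g : ℕ → Ω → S → T → B) : Prop :=
  ∀ k, Measurable[(pastSigma ξ k).prod (mS.prod mT)] fun z : Ω × S × T => g k z.1 z.2.1 z.2.2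

variable {g : ℕ → Ω → S → T → B}

lemma DependsOnPast.measurable_apply (hg : DependsOnPast ξ g) (k : ℕ) :
    Measurable[(pastSigma ξ (k + 1)).prod mT] fun z : Ω × T => g k z.1 (ξ k z.1) z.2 := by
  have hgraph : @Measurable (Ω × T) (Ω × S × T) ((pastSigma ξ (k + 1)).prod mT)
      ((pastSigma ξ k).prod (mS.prod mT)) (fun z => (z.1, ξ k z.1, z.2)) :=
    ((measurable_id'' (pastSigma_mono ξ k.le_succ)).comp measurable_fst).prodMk
      (((measurable_pastSigma ξ k.lt_succ_self).comp measurable_fst).prodMk measurable_snd)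
  exact (hg k).comp hgraph

section Sum

variable [NormedAddCommGroup B] [TopologicalSpace.SeparableSpace B] [BorelSpace B]

lemma DependsOnPast.measurable_sum (hg : DependsOnPast ξ g) (n : ℕ) :
    Measurable[(pastSigma ξ n).prod mT]
      fun z : Ω × T => ∑ k ∈ Finset.range n, g k z.1 (ξ k z.1) z.2 := by
  refine Finset.measurable_sum _ fun k hk => (hg.measurable_apply k).mono ?_ le_rfl
  exact sup_le_sup (MeasurableSpace.comap_mono
    (pastSigma_mono ξ (Nat.succ_le_iff.2 (Finset.mem_range.1 hk)))) le_rfl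

lemma DependsOnPast.measurable_sum' [MeasurableSpace Ω] {P : Measure Ω}
    (hg : DependsOnPast ξ g) (hξ : IsIID P ξ) (n : ℕ) :
    Measurable fun z : Ω × T => ∑ k ∈ Finset.range n, g k z.1 (ξ k z.1) z.2 :=
  (hg.measurable_sum n).mono (hξ.pastSigma_prod_le n) le_rfl

end Sum

lemma DependsOnPast.measurable [MeasurableSpace Ω] {P : Measure Ω}
    (hg : DependsOnPast ξ g) (hξ : IsIID P ξ) (k : ℕ) :
    Measurable fun z : Ω × S × T => g k z.1 z.2.1 z.2.2 :=
  (hg k).mono (hξ.pastSigma_prod_le k) le_rfl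

end Predictable

section Moment

variable {Ω S T B : Type*} [mΩ : MeasurableSpace Ω] [mS : MeasurableSpace S]
  [mT : MeasurableSpace T] [NormedAddCommGroup B] [NormedSpace ℝ B] [CompleteSpace B]
  [TopologicalSpace.SeparableSpace B] [MeasurableSpace B] [BorelSpace B]
  {P : Measure Ω} [IsProbabilityMeasure P] {ξ : ℕ → Ω → S} {ν : Measure T} [SFinite ν]
  {p C : ℝ} {φ : B → ℝ}

lemma IsSmoothGauge.lintegral_lintegral_add_le (hφ : IsSmoothGauge p C φ) (hp : 1 ≤ p)
    {μ : Measure S} [IsProbabilityMeasure μ] {s : T → B} (hs : Measurable s) {f : S → T → B}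
    (hf : Measurable (Function.uncurry f)) (hf0 : ∀ᵐ τ ∂ν, ∫ x, f x τ ∂μ = 0) :
    ∫⁻ x, ∫⁻ τ, ENNReal.ofReal (φ (s τ + f x τ)) ∂ν ∂μ ≤
      ∫⁻ τ, ENNReal.ofReal (φ (s τ)) ∂ν +
        ENNReal.ofReal C * ∫⁻ x, ∫⁻ τ, ‖f x τ‖ₑ ^ p ∂ν ∂μ := by
  have hφm : Measurable fun b => ENNReal.ofReal (φ b) := hφ.continuous.measurable.ennreal_ofReal
  calc ∫⁻ x, ∫⁻ τ, ENNReal.ofReal (φ (s τ + f x τ)) ∂ν ∂μ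
      = ∫⁻ τ, ∫⁻ x, ENNReal.ofReal (φ (s τ + f x τ)) ∂μ ∂ν :=
        lintegral_lintegral_swap (hφm.comp ((hs.comp measurable_snd).add hf)).aemeasurable
    _ ≤ ∫⁻ τ, (ENNReal.ofReal (φ (s τ)) + ENNReal.ofReal C * ∫⁻ x, ‖f x τ‖ₑ ^ p ∂μ) ∂ν := by
        refine lintegral_mono_ae (hf0.mono fun τ hτ => ?_)
        exact hφ.lintegral_add_le hp (hf.comp measurable_prodMk_right).aestronglyMeasurable hτ _
    _ = _ := by
        rw [lintegral_add_left (f := fun τ => ENNReal.ofReal (φ (s τ))) (hφm.comp hs),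
          lintegral_const_mul' _ _ ENNReal.ofReal_ne_top,
          lintegral_lintegral_swap (f := fun τ x => ‖f x τ‖ₑ ^ p)
            ((hf.comp measurable_swap).enorm.pow_const p).aemeasurable]

variable {g : ℕ → Ω → S → T → B}

lemma IsSmoothGauge.lintegral_sum_succ_le (hφ : IsSmoothGauge p C φ) (hp : 1 ≤ p)
    (hξ : IsIID P ξ) (hg : DependsOnPast ξ g) {n : ℕ}
    (hg0 : ∀ᵐ z ∂(P.prod ν), ∫ x, g n z.1 x z.2 ∂(P.map (ξ 0)) = 0) :
    ∫⁻ ω, ∫⁻ τ, ENNReal.ofReal (φ (∑ k ∈ Finset.range (n + 1), g k ω (ξ k ω) τ)) ∂ν ∂P ≤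
      ∫⁻ ω, ∫⁻ τ, ENNReal.ofReal (φ (∑ k ∈ Finset.range n, g k ω (ξ k ω) τ)) ∂ν ∂P +
        ENNReal.ofReal C * ∫⁻ ω, ∫⁻ x, ∫⁻ τ, ‖g n ω x τ‖ₑ ^ p ∂ν ∂(P.map (ξ 0)) ∂P := by
  have := hξ.isProbabilityMeasure_map
  set s : Ω → T → B := fun ω τ => ∑ k ∈ Finset.range n, g k ω (ξ k ω) τ
  have hφm : Measurable fun b => ENNReal.ofReal (φ b) := hφ.continuous.measurable.ennreal_ofReal
  have hs : Measurable (Function.uncurry s) := hg.measurable_sum' hξ n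
  have hsg : @Measurable ((Ω × S) × T) B (((pastSigma ξ n).prod mS).prod mT) _
      (fun z => s z.1.1 z.2 + g n z.1.1 z.1.2 z.2) := by
    have hfst : @Measurable ((Ω × S) × T) Ω (((pastSigma ξ n).prod mS).prod mT) (pastSigma ξ n)
      (fun z => z.1.1) := measurable_fst.comp measurable_fst
    exact ((hg.measurable_sum n).comp (hfst.prodMk measurable_snd)).add ((hg n).comp
      (hfst.prodMk ((measurable_snd.comp measurable_fst).prodMk measurable_snd)))
  have hfresh := lintegral_indep (hξ.pastSigma_le n) (hξ.measurable n) (hξ.indep_pastSigma n)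
    (G := fun ω x => ∫⁻ τ, ENNReal.ofReal (φ (s ω τ + g n ω x τ)) ∂ν)
    (@Measurable.lintegral_prod_right' _ _ ((pastSigma ξ n).prod mS) _ _ _ _ (hφm.comp hsg))
  rw [hξ.map_eq] at hfresh
  calc ∫⁻ ω, ∫⁻ τ, ENNReal.ofReal (φ (∑ k ∈ Finset.range (n + 1), g k ω (ξ k ω) τ)) ∂ν ∂P
      = ∫⁻ ω, ∫⁻ x, ∫⁻ τ, ENNReal.ofReal (φ (s ω τ + g n ω x τ)) ∂ν ∂(P.map (ξ 0)) ∂P := by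
        rw [← hfresh]; simp only [Finset.sum_range_succ, s]
    _ ≤ ∫⁻ ω, (∫⁻ τ, ENNReal.ofReal (φ (s ω τ)) ∂ν +
          ENNReal.ofReal C * ∫⁻ x, ∫⁻ τ, ‖g n ω x τ‖ₑ ^ p ∂ν ∂(P.map (ξ 0))) ∂P := by
        refine lintegral_mono_ae ((Measure.ae_ae_of_ae_prod hg0).mono fun ω hω => ?_)
        exact hφ.lintegral_lintegral_add_le hp (hs.comp measurable_prodMk_left)
          ((hg.measurable hξ n).comp measurable_prodMk_left) hω
    _ = _ := by
        rw [lintegral_add_left (f := fun ω => ∫⁻ τ, ENNReal.ofReal (φ (s ω τ)) ∂ν)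
            (Measurable.lintegral_prod_right' (hφm.comp hs)),
          lintegral_const_mul' _ _ ENNReal.ofReal_ne_top]

lemma IsSmoothGauge.lintegral_sum_le (hφ : IsSmoothGauge p C φ) (hp : 1 ≤ p)
    (hξ : IsIID P ξ) (hg : DependsOnPast ξ g)
    (hg0 : ∀ k, ∀ᵐ z ∂(P.prod ν), ∫ x, g k z.1 x z.2 ∂(P.map (ξ 0)) = 0) (n : ℕ) :
    ∫⁻ ω, ∫⁻ τ, ENNReal.ofReal (φ (∑ k ∈ Finset.range n, g k ω (ξ k ω) τ)) ∂ν ∂P ≤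
      ENNReal.ofReal C * ∑ k ∈ Finset.range n,
        ∫⁻ ω, ∫⁻ x, ∫⁻ τ, ‖g k ω x τ‖ₑ ^ p ∂ν ∂(P.map (ξ 0)) ∂P := by
  induction n with
  | zero => simp [hφ.map_zero]
  | succ n ih =>
    refine (hφ.lintegral_sum_succ_le hp hξ hg (hg0 n)).trans ?_
    rw [Finset.sum_range_succ, mul_add]
    gcongr

end Moment

/-! ### The good-`λ` inequality -/

lemma exists_Ico_eq_crossing {α : Type*} [LinearOrder α] {z : ℕ → α} {s t : α} (hst : s ≤ t)
    (h0 : z 0 ≤ s) {N : ℕ} (hN : ∃ n ≤ N, t < z n) :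
    ∃ a b, a < b ∧ b ≤ N ∧ z a ≤ s ∧ t < z b ∧
      ∀ k, k ∈ Finset.Ico (a + 1) b ↔ (∃ j ≤ k, s < z j) ∧ ∀ j ≤ k, z j ≤ t := by
  have hpass_t : ∃ n, t < z n := hN.imp fun n hn => hn.2
  have hpass_s : ∃ n, s < z n := hpass_t.imp fun n hn => hst.trans_lt hn
  have hfirst : Nat.find hpass_s ≠ 0 := fun h => by
    have := Nat.find_spec hpass_s
    rw [h] at this
    exact absurd this h0.not_gt
  obtain ⟨a, ha⟩ := Nat.exists_eq_succ_of_ne_zero hfirst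
  have hab : a + 1 ≤ Nat.find hpass_t :=
    ha.ge.trans (Nat.find_min' hpass_s (hst.trans_lt (Nat.find_spec hpass_t)))
  refine ⟨a, Nat.find hpass_t, hab, ?_, not_lt.1 (Nat.find_min hpass_s (by omega)),
    Nat.find_spec hpass_t, fun k => ?_⟩
  · obtain ⟨n, hnN, hn⟩ := hN
    exact (Nat.find_min' hpass_t hn).trans hnN
  · rw [Finset.mem_Ico, ← Nat.succ_eq_add_one, ← ha, Nat.find_le_iff, Nat.lt_find_iff]
    simp only [not_lt]

lemma two_mul_le_eLpNorm'_sum_crossing_add {T B : Type*} [MeasurableSpace T]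
    [NormedAddCommGroup B] {ν : Measure T} {p : ℝ} (hp : 1 ≤ p) {d : ℕ → T → B}
    (hd : ∀ k, AEStronglyMeasurable (d k) ν) {t ε : ℝ≥0∞} {N : ℕ}
    (hN : ∃ n ≤ N, 2 * t < eLpNorm' (fun τ => ∑ k ∈ Finset.range n, d k τ) p ν)
    (hε : ∀ k < N, eLpNorm' (d k) p ν ≤ ε) {E : Set ℕ}
    (hE : ∀ k < N, k ∈ E ↔
      (∃ j ≤ k, t < eLpNorm' (fun τ => ∑ i ∈ Finset.range j, d i τ) p ν) ∧
      ∀ j ≤ k, eLpNorm' (fun τ => ∑ i ∈ Finset.range j, d i τ) p ν ≤ 2 * t) :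
    2 * t ≤ t + ε +
      eLpNorm' (fun τ => ∑ k ∈ Finset.range N, E.indicator (fun k => d k τ) k) p ν := by
  classical
  have hzero : eLpNorm' (fun τ => ∑ k ∈ Finset.range 0, d k τ) p ν ≤ t := by
    simp [eLpNorm'_eq_lintegral_enorm, show 0 < p by linarith]
  obtain ⟨a, b, hab, hbN, hat, htb, hcross⟩ :=
    exists_Ico_eq_crossing (le_mul_of_one_le_left zero_le one_le_two) hzero hN
  have hIco : ∀ τ, ∑ k ∈ Finset.range N, E.indicator (fun k => d k τ) k =
      ∑ k ∈ Finset.Ico (a + 1) b, d k τ := fun τ => by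
    simp only [Set.indicator_apply]
    rw [← Finset.sum_filter]
    refine Finset.sum_congr (Finset.ext fun k => ?_) fun _ _ => rfl
    rw [Finset.mem_filter, Finset.mem_range]
    refine ⟨fun ⟨hkN, hkE⟩ => (hcross k).2 ((hE k hkN).1 hkE), fun hk => ?_⟩
    have hkN : k < N := (Finset.mem_Ico.1 hk).2.trans_le hbN
    exact ⟨hkN, (hE k hkN).2 ((hcross k).1 hk)⟩
  have hsplit : (fun τ => ∑ k ∈ Finset.range b, d k τ) =
      ((fun τ => ∑ k ∈ Finset.range a, d k τ) + d a) +
        fun τ => ∑ k ∈ Finset.Ico (a + 1) b, d k τ := by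
    ext τ
    simp only [Pi.add_apply, ← Finset.sum_range_succ]
    exact (Finset.sum_range_add_sum_Ico (fun k => d k τ) hab).symm
  have hmeas : ∀ s : Finset ℕ, AEStronglyMeasurable (fun τ => ∑ k ∈ s, d k τ) ν :=
    fun s => s.aestronglyMeasurable_fun_sum fun k _ => hd k
  simp only [hIco]
  calc 2 * t ≤ eLpNorm' (fun τ => ∑ k ∈ Finset.range b, d k τ) p ν := htb.le
    _ ≤ eLpNorm' (fun τ => ∑ k ∈ Finset.range a, d k τ) p ν + eLpNorm' (d a) p ν +
          eLpNorm' (fun τ => ∑ k ∈ Finset.Ico (a + 1) b, d k τ) p ν := by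
        rw [hsplit]
        exact (eLpNorm'_add_le ((hmeas _).add (hd a)) (hmeas _) hp).trans
          (add_le_add (eLpNorm'_add_le (hmeas _) (hd a) hp) le_rfl)
    _ ≤ _ := by gcongr; exact hε a (hab.trans_le hbN)

lemma sum_indicator_le_of_partial_sum_le {V : ℕ → ℝ≥0∞} {c : ℝ≥0∞} {E : Set ℕ}
    (h : ∀ k ∈ E, ∑ j ∈ Finset.range (k + 1), V j ≤ c) (N : ℕ) :
    ∑ k ∈ Finset.range N, E.indicator V k ≤ c := by
  induction N with
  | zero => simp
  | succ n ih =>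
    by_cases hn : n ∈ E
    · exact (Finset.sum_le_sum fun k _ => Set.indicator_le_self' (fun _ _ => zero_le) k).trans
        (h n hn)
    · simpa [Finset.sum_range_succ, hn] using ih

section Increments

variable {Ω S T B : Type*} [mS : MeasurableSpace S] [mT : MeasurableSpace T]
  [NormedAddCommGroup B] (p : ℝ) (μ : Measure S) (ν : Measure T) (ξ : ℕ → Ω → S)
  (g : ℕ → Ω → S → T → B)

/-- The `L^p(ν)` norm, in the parameter, of the sum of the first `n` increments. -/
def partialSumNorm (n : ℕ) (ω : Ω) : ℝ≥0∞ :=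
  eLpNorm' (fun τ => ∑ k ∈ Finset.range n, g k ω (ξ k ω) τ) p ν

/-- The conditional `p`-th moment of the `k`-th increment given the past, when the fresh variable
has law `μ`. -/
def incrementMoment (k : ℕ) (ω : Ω) : ℝ≥0∞ :=
  ∫⁻ x, ∫⁻ τ, ‖g k ω x τ‖ₑ ^ p ∂ν ∂μ

/-- The event that at time `k` the partial sums have passed the level `t` but not yet `2 * t`, while
the conditional moments of the increments up to the `k`-th one add up to at most `v`. -/
def crossingEvent (t v : ℝ≥0∞) (k : ℕ) : Set Ω :=
  {ω | (∃ j ≤ k, t < partialSumNorm p ν ξ g j ω) ∧ (∀ j ≤ k, partialSumNorm p ν ξ g j ω ≤ 2 * t) ∧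
    ∑ j ∈ Finset.range (k + 1), incrementMoment p μ ν g j ω ≤ v}

/-- The increments, set to zero outside the crossing events. -/
def crossingIncrement (t v : ℝ≥0∞) (k : ℕ) (ω : Ω) (x : S) (τ : T) : B :=
  (crossingEvent p μ ν ξ g t v k).indicator (fun ω' => g k ω' x τ) ω

variable {p μ ν ξ g} {t v : ℝ≥0∞}

lemma incrementMoment_crossingIncrement (hp : 0 < p) (k : ℕ) (ω : Ω) :
    incrementMoment p μ ν (crossingIncrement p μ ν ξ g t v) k ω =
      (crossingEvent p μ ν ξ g t v k).indicator (incrementMoment p μ ν g k) ω := by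
  by_cases hω : ω ∈ crossingEvent p μ ν ξ g t v k <;>
    simp [incrementMoment, crossingIncrement, hω, hp]

lemma sum_incrementMoment_crossingIncrement_le (hp : 0 < p) (N : ℕ) (ω : Ω) :
    ∑ k ∈ Finset.range N, incrementMoment p μ ν (crossingIncrement p μ ν ξ g t v) k ω ≤
      {ω | ∃ n ≤ N, t < partialSumNorm p ν ξ g n ω}.indicator (fun _ => v) ω := by
  simp only [incrementMoment_crossingIncrement hp]
  by_cases hω : ∃ n ≤ N, t < partialSumNorm p ν ξ g n ω
  · rw [Set.indicator_of_mem (show ω ∈ {ω | ∃ n ≤ N, t < partialSumNorm p ν ξ g n ω} from hω)]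
    exact sum_indicator_le_of_partial_sum_le (V := fun k => incrementMoment p μ ν g k ω)
      (E := {k | ω ∈ crossingEvent p μ ν ξ g t v k}) (fun k hk => hk.2.2) N
  · refine (Finset.sum_eq_zero fun k hk => Set.indicator_of_notMem (fun hkE => hω ?_) _).trans_le
      zero_le
    obtain ⟨j, hj, hjt⟩ := hkE.1
    exact ⟨j, hj.trans (Finset.mem_range.1 hk).le, hjt⟩

section Measurability

variable [MeasurableSpace B] [BorelSpace B] [SFinite ν]

lemma DependsOnPast.measurable_lintegral_enorm (hg : DependsOnPast ξ g) (k : ℕ) :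
    Measurable[(pastSigma ξ k).prod mS] fun z : Ω × S => ∫⁻ τ, ‖g k z.1 z.2 τ‖ₑ ^ p ∂ν := by
  have hassoc : @Measurable ((Ω × S) × T) (Ω × S × T) (((pastSigma ξ k).prod mS).prod mT)
      ((pastSigma ξ k).prod (mS.prod mT)) (fun z => (z.1.1, z.1.2, z.2)) :=
    (measurable_fst.comp measurable_fst).prodMk
      ((measurable_snd.comp measurable_fst).prodMk measurable_snd)
  exact @Measurable.lintegral_prod_right' _ _ ((pastSigma ξ k).prod mS) _ _ _ _
    ((measurable_enorm.pow_const p).comp ((hg k).comp hassoc))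

lemma DependsOnPast.measurable_incrementMoment [SFinite μ] (hg : DependsOnPast ξ g) (k : ℕ) :
    Measurable[pastSigma ξ k] (incrementMoment p μ ν g k) :=
  @Measurable.lintegral_prod_right' _ _ (pastSigma ξ k) _ _ _ _ (hg.measurable_lintegral_enorm k)

variable [TopologicalSpace.SeparableSpace B]

lemma DependsOnPast.measurable_partialSumNorm (hg : DependsOnPast ξ g) (n : ℕ) :
    Measurable[pastSigma ξ n] (partialSumNorm p ν ξ g n) :=
  (measurable_id.pow_const (1 / p)).comp
    (@Measurable.lintegral_prod_right' _ _ (pastSigma ξ n) _ _ _ _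
      ((measurable_enorm.pow_const p).comp (hg.measurable_sum n)))

lemma DependsOnPast.measurableSet_exists_lt (hg : DependsOnPast ξ g) (k : ℕ) :
    MeasurableSet[pastSigma ξ k] {ω | ∃ j ≤ k, t < partialSumNorm p ν ξ g j ω} := by
  have hunion : {ω | ∃ j ≤ k, t < partialSumNorm p ν ξ g j ω} =
      ⋃ j ∈ Set.Iic k, {ω | t < partialSumNorm p ν ξ g j ω} := by ext; simp
  rw [hunion]
  exact MeasurableSet.biUnion (Set.to_countable _) fun j hj => measurableSet_lt measurable_const
    ((hg.measurable_partialSumNorm j).mono (pastSigma_mono ξ hj) le_rfl)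

lemma DependsOnPast.measurableSet_crossingEvent [SFinite μ] (hg : DependsOnPast ξ g) (k : ℕ) :
    MeasurableSet[pastSigma ξ k] (crossingEvent p μ ν ξ g t v k) := by
  have hinter : crossingEvent p μ ν ξ g t v k =
      {ω | ∃ j ≤ k, t < partialSumNorm p ν ξ g j ω} ∩
        ({ω | ∃ j ≤ k, 2 * t < partialSumNorm p ν ξ g j ω}ᶜ ∩
          {ω | ∑ j ∈ Finset.range (k + 1), incrementMoment p μ ν g j ω ≤ v}) := by
    ext
    simp [crossingEvent]
  rw [hinter]
  refine (hg.measurableSet_exists_lt k).inter ((hg.measurableSet_exists_lt k).compl.inter ?_)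
  refine measurableSet_le (Finset.measurable_sum _ fun j hj => ?_) measurable_const
  exact (hg.measurable_incrementMoment j).mono
    (pastSigma_mono ξ (Nat.lt_succ_iff.1 (Finset.mem_range.1 hj))) le_rfl

lemma DependsOnPast.crossingIncrement [SFinite μ] (hg : DependsOnPast ξ g) :
    DependsOnPast ξ (crossingIncrement p μ ν ξ g t v) := fun k => by
  classical
  exact Measurable.ite (measurable_fst (hg.measurableSet_crossingEvent k)) (hg k) measurable_const

end Measurability

lemma two_mul_le_partialSumNorm_crossingIncrement_add (hp : 1 ≤ p) {ω : Ω}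
    (hd : ∀ k, AEStronglyMeasurable (g k ω (ξ k ω)) ν) {ε : ℝ≥0∞} {N : ℕ}
    (hN : ∃ n ≤ N, 2 * t < partialSumNorm p ν ξ g n ω)
    (hε : ∀ k < N, eLpNorm' (g k ω (ξ k ω)) p ν ≤ ε)
    (hv : ∑ k ∈ Finset.range N, incrementMoment p μ ν g k ω ≤ v) :
    2 * t ≤ t + ε + partialSumNorm p ν ξ (crossingIncrement p μ ν ξ g t v) N ω :=
  two_mul_le_eLpNorm'_sum_crossing_add hp hd hN hε
    (E := {k | ω ∈ crossingEvent p μ ν ξ g t v k}) fun _ hk =>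
      ⟨fun h => ⟨h.1, h.2.1⟩, fun h => ⟨h.1, h.2,
        (Finset.sum_le_sum_of_subset (Finset.range_mono hk)).trans hv⟩⟩

end Increments

section GoodLambda

variable {Ω S T B : Type*} [MeasurableSpace Ω] [MeasurableSpace S] [MeasurableSpace T]
  [NormedAddCommGroup B] [NormedSpace ℝ B] [CompleteSpace B]
  [TopologicalSpace.SeparableSpace B] [MeasurableSpace B] [BorelSpace B]
  {P : Measure Ω} [IsProbabilityMeasure P] {ξ : ℕ → Ω → S} {ν : Measure T} [SFinite ν]
  {p C : ℝ} {φ : B → ℝ} {g : ℕ → Ω → S → T → B}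

lemma IsSmoothGauge.lintegral_partialSumNorm_rpow_le (hφ : IsSmoothGauge p C φ) (hp : 1 ≤ p)
    (hξ : IsIID P ξ) (hg : DependsOnPast ξ g)
    (hg0 : ∀ k, ∀ᵐ z ∂(P.prod ν), ∫ x, g k z.1 x z.2 ∂(P.map (ξ 0)) = 0) (n : ℕ) :
    ∫⁻ ω, partialSumNorm p ν ξ g n ω ^ p ∂P ≤
      ENNReal.ofReal C * ∫⁻ ω, ∑ k ∈ Finset.range n,
        incrementMoment p (P.map (ξ 0)) ν g k ω ∂P := by
  have hp0 : 0 < p := by linarith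
  have := hξ.isProbabilityMeasure_map
  rw [lintegral_finsetSum _ fun k _ =>
    (hg.measurable_incrementMoment k).mono (hξ.pastSigma_le k) le_rfl]
  refine (lintegral_mono fun ω => ?_).trans (hφ.lintegral_sum_le hp hξ hg hg0 n)
  simp only [partialSumNorm]
  rw [← lintegral_rpow_enorm_eq_rpow_eLpNorm' hp0]
  refine lintegral_mono fun τ => ?_
  rw [← ofReal_norm, ENNReal.ofReal_rpow_of_nonneg (norm_nonneg _) hp0.le]
  exact ENNReal.ofReal_le_ofReal (hφ.norm_rpow_le _)

lemma IsSmoothGauge.lintegral_partialSumNorm_crossingIncrement_rpow_le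
    (hφ : IsSmoothGauge p C φ) (hp : 1 ≤ p) (hξ : IsIID P ξ) (hg : DependsOnPast ξ g)
    (hg0 : ∀ k, ∀ᵐ z ∂(P.prod ν), ∫ x, g k z.1 x z.2 ∂(P.map (ξ 0)) = 0) (t v : ℝ≥0∞) (N : ℕ) :
    ∫⁻ ω, partialSumNorm p ν ξ (crossingIncrement p (P.map (ξ 0)) ν ξ g t v) N ω ^ p ∂P ≤
      ENNReal.ofReal C * (v * P {ω | ∃ n ≤ N, t < partialSumNorm p ν ξ g n ω}) := by
  have := hξ.isProbabilityMeasure_map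
  have hcentred : ∀ k, ∀ᵐ z ∂(P.prod ν),
      ∫ x, crossingIncrement p (P.map (ξ 0)) ν ξ g t v k z.1 x z.2 ∂(P.map (ξ 0)) = 0 := fun k => by
    filter_upwards [hg0 k] with z hz
    by_cases h : z.1 ∈ crossingEvent p (P.map (ξ 0)) ν ξ g t v k <;>
      simp [crossingIncrement, h, hz]
  refine (hφ.lintegral_partialSumNorm_rpow_le hp hξ hg.crossingIncrement hcentred N).trans ?_
  gcongr
  refine (lintegral_mono fun ω =>
    sum_incrementMoment_crossingIncrement_le (by linarith) N ω).trans_eq ?_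
  rw [lintegral_indicator (hξ.pastSigma_le N _ (hg.measurableSet_exists_lt N)), setLIntegral_const]

lemma IsSmoothGauge.measure_half_le_partialSumNorm_crossingIncrement_le
    (hφ : IsSmoothGauge p C φ) (hp : 1 ≤ p) (hξ : IsIID P ξ) (hg : DependsOnPast ξ g)
    (hg0 : ∀ k, ∀ᵐ z ∂(P.prod ν), ∫ x, g k z.1 x z.2 ∂(P.map (ξ 0)) = 0)
    {t δ : ℝ≥0} (ht : t ≠ 0) (N : ℕ) :
    P {ω | ((t / 2 : ℝ≥0) : ℝ≥0∞) ≤ partialSumNorm p ν ξ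
        (crossingIncrement p (P.map (ξ 0)) ν ξ g t ((δ * t : ℝ≥0∞) ^ p)) N ω} ≤
      ENNReal.ofReal C * (2 * δ) ^ p *
        P {ω | ∃ n ≤ N, (t : ℝ≥0∞) < partialSumNorm p ν ξ g n ω} := by
  have hp0 : 0 < p := by linarith
  have := hξ.isProbabilityMeasure_map
  have ht0 : ((t / 2 : ℝ≥0) : ℝ≥0∞) ^ p ≠ 0 := by simp [ENNReal.rpow_eq_zero_iff, ht, hp0.le]
  have ht_top : ((t / 2 : ℝ≥0) : ℝ≥0∞) ^ p ≠ ∞ :=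
    ENNReal.rpow_ne_top_of_nonneg hp0.le ENNReal.coe_ne_top
  have hdil : (δ * t : ℝ≥0∞) = (2 * δ) * ((t / 2 : ℝ≥0) : ℝ≥0∞) := by
    norm_cast
    field_simp
  have hmeas : Measurable (partialSumNorm p ν ξ
      (crossingIncrement p (P.map (ξ 0)) ν ξ g t ((δ * t : ℝ≥0∞) ^ p)) N) :=
    (hg.crossingIncrement.measurable_partialSumNorm N).mono (hξ.pastSigma_le N) le_rfl
  have hmarkov := mul_meas_ge_le_lintegral (μ := P) (hmeas.pow_const p)
    (((t / 2 : ℝ≥0) : ℝ≥0∞) ^ p)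
  simp only [ENNReal.rpow_le_rpow_iff hp0] at hmarkov
  rw [← ENNReal.mul_le_mul_iff_right ht0 ht_top]
  refine (hmarkov.trans (hφ.lintegral_partialSumNorm_crossingIncrement_rpow_le hp hξ hg hg0
    t _ N)).trans_eq ?_
  rw [hdil, ENNReal.mul_rpow_of_nonneg _ _ hp0.le]
  ring

lemma IsSmoothGauge.good_lambda (hφ : IsSmoothGauge p C φ) (hp : 1 ≤ p) (hξ : IsIID P ξ)
    (hg : DependsOnPast ξ g)
    (hg0 : ∀ k, ∀ᵐ z ∂(P.prod ν), ∫ x, g k z.1 x z.2 ∂(P.map (ξ 0)) = 0)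
    {t δ : ℝ≥0} (ht : t ≠ 0) (hδ : 2 * δ ≤ 1) (N : ℕ) :
    P {ω | ∃ n ≤ N, 2 * (t : ℝ≥0∞) < partialSumNorm p ν ξ g n ω} ≤
      ENNReal.ofReal C * (2 * δ) ^ p *
        P {ω | ∃ n ≤ N, (t : ℝ≥0∞) < partialSumNorm p ν ξ g n ω} +
      (∑ k ∈ Finset.range N, P {ω | (δ * t : ℝ≥0∞) < eLpNorm' (g k ω (ξ k ω)) p ν} +
        P {ω | (δ * t : ℝ≥0∞) ^ p <
          ∑ k ∈ Finset.range N, incrementMoment p (P.map (ξ 0)) ν g k ω}) := by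
  have hcover : {ω | ∃ n ≤ N, 2 * (t : ℝ≥0∞) < partialSumNorm p ν ξ g n ω} ⊆
      {ω | ((t / 2 : ℝ≥0) : ℝ≥0∞) ≤ partialSumNorm p ν ξ
        (crossingIncrement p (P.map (ξ 0)) ν ξ g t ((δ * t : ℝ≥0∞) ^ p)) N ω} ∪
      ((⋃ k ∈ Finset.range N, {ω | (δ * t : ℝ≥0∞) < eLpNorm' (g k ω (ξ k ω)) p ν}) ∪
        {ω | (δ * t : ℝ≥0∞) ^ p <
          ∑ k ∈ Finset.range N, incrementMoment p (P.map (ξ 0)) ν g k ω}) := by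
    intro ω hω
    by_contra hcon
    simp only [Set.mem_union, Set.mem_iUnion, Set.mem_ofPred_eq, not_or, not_exists, not_lt,
      not_le, Finset.mem_range] at hcon
    obtain ⟨hsmall, hjump, hvar⟩ := hcon
    have hmeas : ∀ k, AEStronglyMeasurable (g k ω (ξ k ω)) ν := fun k =>
      (((hg.measurable_apply k).mono (hξ.pastSigma_prod_le _) le_rfl).comp
        measurable_prodMk_left).aestronglyMeasurable
    have hδt : (t + δ * t + (t / 2 : ℝ≥0) : ℝ≥0) ≤ 2 * t := by
      have : 2 * δ * t ≤ 1 * t := by gcongr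
      rw [← NNReal.coe_le_coe] at this ⊢
      push_cast at this ⊢
      linarith
    refine (two_mul_le_partialSumNorm_crossingIncrement_add hp hmeas hω hjump hvar).not_gt
      (lt_of_lt_of_le (ENNReal.add_lt_add_left (by finiteness) hsmall) ?_)
    exact_mod_cast hδt
  refine (measure_mono hcover).trans ((measure_union_le _ _).trans (add_le_add
    (hφ.measure_half_le_partialSumNorm_crossingIncrement_le hp hξ hg hg0 ht N) ?_))
  exact (measure_union_le _ _).trans (add_le_add (measure_biUnion_finset_le _ _) le_rfl)

end GoodLambda

/-! ### The recursion for `U`-statistics -/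

/-- The extension of an order embedding that sends the new last point to the new last point. -/
def snocOrderEmb {m n : ℕ} (i : Fin m ↪o Fin n) : Fin (m + 1) ↪o Fin (n + 1) :=
  OrderEmbedding.ofStrictMono
    (Fin.snoc (α := fun _ => Fin (n + 1)) (fun l => (i l).castSucc) (Fin.last n)) (by
      intro a b hab
      induction b using Fin.lastCases with
      | last =>
        obtain ⟨a, rfl⟩ := Fin.exists_castSucc_eq.2 hab.ne
        simp [Fin.castSucc_lt_last]
      | cast b =>
        obtain ⟨a, rfl⟩ := Fin.exists_castSucc_eq.2 (hab.trans (Fin.castSucc_lt_last b)).ne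
        simpa using hab)

section Combinatorics

variable {m n : ℕ}

lemma snocOrderEmb_castSucc (i : Fin m ↪o Fin n) (l : Fin m) :
    snocOrderEmb i l.castSucc = (i l).castSucc :=
  Fin.snoc_castSucc (α := fun _ => Fin (n + 1)) (Fin.last n) (fun l => (i l).castSucc) l

lemma snocOrderEmb_last (i : Fin m ↪o Fin n) : snocOrderEmb i (Fin.last m) = Fin.last n :=
  Fin.snoc_last (α := fun _ => Fin (n + 1)) (Fin.last n) (fun l => (i l).castSucc)

lemma exists_trans_castSuccOrderEmb_eq {α : Type*} [PartialOrder α] (j : α ↪o Fin (n + 1))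
    (hj : ∀ a, j a ≠ Fin.last n) : ∃ i : α ↪o Fin n, i.trans Fin.castSuccOrderEmb = j :=
  ⟨OrderEmbedding.ofMapLEIff (fun a => (j a).castPred (hj a)) fun a b => by simp,
    RelEmbedding.ext fun _ => rfl⟩

lemma exists_snocOrderEmb_eq (j : Fin (m + 1) ↪o Fin (n + 1))
    (hj : j (Fin.last m) = Fin.last n) : ∃ i : Fin m ↪o Fin n, snocOrderEmb i = j := by
  obtain ⟨i, hi⟩ := exists_trans_castSuccOrderEmb_eq (Fin.castSuccOrderEmb.trans j) fun l h =>
    (Fin.castSucc_lt_last l).ne (j.injective (h.trans hj.symm))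
  refine ⟨i, RelEmbedding.ext fun l => ?_⟩
  induction l using Fin.lastCases with
  | last => rw [snocOrderEmb_last, hj]
  | cast l => exact (snocOrderEmb_castSucc i l).trans (DFunLike.congr_fun hi l)

lemma orderEmb_succ_bijective (m n : ℕ) :
    Function.Bijective (Sum.elim (fun i : Fin (m + 1) ↪o Fin n => i.trans Fin.castSuccOrderEmb)
      (snocOrderEmb (m := m) (n := n))) := by
  constructor
  · refine Function.Injective.sumElim (fun i j hij => ?_) (fun i j hij => ?_) fun i j hij => ?_
    · exact RelEmbedding.ext fun l => Fin.castSucc_injective n (DFunLike.congr_fun hij l)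
    · refine RelEmbedding.ext fun l => Fin.castSucc_injective n ?_
      rw [← snocOrderEmb_castSucc, ← snocOrderEmb_castSucc, hij]
    · have hlast := DFunLike.congr_fun hij (Fin.last m)
      rw [snocOrderEmb_last] at hlast
      exact (Fin.castSucc_lt_last _).ne hlast
  · intro j
    by_cases hj : j (Fin.last m) = Fin.last n
    · obtain ⟨i, hi⟩ := exists_snocOrderEmb_eq j hj
      exact ⟨Sum.inr i, hi⟩
    · obtain ⟨i, hi⟩ := exists_trans_castSuccOrderEmb_eq j fun l hl =>
        hj (le_antisymm (Fin.le_last _) (hl ▸ j.map_rel_iff.2 (Fin.le_last l)))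
      exact ⟨Sum.inl i, hi⟩

section UStat

variable {Ω S B : Type*} [AddCommMonoid B] (ξ : ℕ → Ω → S)

lemma uStat_succ (h : (Fin (m + 1) → S) → B) (n : ℕ) (ω : Ω) :
    uStat ξ h (n + 1) ω =
      uStat ξ h n ω + uStat ξ (fun y => h (Fin.snoc (α := fun _ => S) y (ξ n ω))) n ω := by
  simp only [uStat]
  rw [← (orderEmb_succ_bijective m n).sum_comp, Fintype.sum_sum_type]
  congr 1
  refine Finset.sum_congr rfl fun i _ => congrArg h (funext fun l => ?_)
  induction l using Fin.lastCases with
  | last => simp [snocOrderEmb_last]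
  | cast l => simp [snocOrderEmb_castSucc]

lemma uStat_eq_sum_range (h : (Fin (m + 1) → S) → B) (n : ℕ) (ω : Ω) :
    uStat ξ h n ω = ∑ k ∈ Finset.range n,
      uStat ξ (fun y => h (Fin.snoc (α := fun _ => S) y (ξ k ω))) k ω := by
  induction n with
  | zero =>
    have : IsEmpty (Fin (m + 1) ↪o Fin 0) := ⟨fun i => (i 0).elim0⟩
    simp [uStat]
  | succ n ih => rw [uStat_succ, ih, Finset.sum_range_succ]

lemma uStat_order_zero (h : (Fin 0 → S) → B) (n : ℕ) (ω : Ω) (y : Fin 0 → S) :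
    uStat ξ h n ω = h y := by
  have : Unique (Fin 0 ↪o Fin n) := ⟨⟨OrderEmbedding.ofIsEmpty⟩, fun i => by ext l; exact l.elim0⟩
  rw [uStat, Fintype.sum_unique]
  exact congrArg h (Subsingleton.elim _ _)

end UStat

lemma sum_finset_fin_succ {M : Type*} [AddCommMonoid M] (f : Finset (Fin (m + 1)) → M) :
    ∑ J, f J = ∑ J : Finset (Fin m), f (J.map Fin.castSuccEmb) +
      ∑ J : Finset (Fin m), f (insert (Fin.last m) (J.map Fin.castSuccEmb)) := by
  have huniv : (Finset.univ : Finset (Finset (Fin (m + 1)))) =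
      (insert (Fin.last m) (Finset.univ.map Fin.castSuccEmb)).powerset := by
    rw [← Finset.powerset_univ]
    congr 1
    ext l
    induction l using Fin.lastCases <;> simp
  have hpowerset : ∀ F : Finset (Fin (m + 1)) → M,
      ∑ J ∈ (Finset.univ.map (Fin.castSuccEmb (n := m))).powerset, F J =
        ∑ J : Finset (Fin m), F (J.map Fin.castSuccEmb) := fun F => by
    refine (Finset.sum_bij (fun J _ => J.map Fin.castSuccEmb) (fun J _ => by simp)
      (fun J _ J' _ h => Finset.map_injective _ h) (fun J hJ => ?_) fun _ _ => rfl).symm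
    obtain ⟨u, _, hu⟩ := Finset.subset_map_iff.1 (Finset.mem_powerset.1 hJ)
    exact ⟨u, Finset.mem_univ _, hu.symm⟩
  rw [huniv, Finset.sum_powerset_insert (by simp), hpowerset, hpowerset]

end Combinatorics

/-! ### Product measures -/

section Product

variable {S : Type*} [MeasurableSpace S]

lemma measurable_snoc (m : ℕ) :
    Measurable fun z : (Fin m → S) × S => Fin.snoc (α := fun _ => S) z.1 z.2 := by
  refine measurable_pi_iff.2 fun l => ?_
  induction l using Fin.lastCases with
  | last => simpa using measurable_snd
  | cast l => simpa using (measurable_pi_apply l).fun_comp measurable_fst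

lemma measurable_piecewise {ι : Type*} [DecidableEq ι] (J : Finset ι) :
    Measurable fun z : (ι → S) × (ι → S) => J.piecewise z.1 z.2 := by
  refine measurable_pi_iff.2 fun l => ?_
  by_cases hl : l ∈ J
  · simpa [hl] using (measurable_pi_apply l).fun_comp measurable_fst
  · simpa [hl] using (measurable_pi_apply l).fun_comp measurable_snd

lemma measurePreserving_piecewise {μ : Measure S} [IsProbabilityMeasure μ] {ι : Type*} [Fintype ι]
    [DecidableEq ι] (J : Finset ι) :
    MeasurePreserving (fun z : (ι → S) × (ι → S) => J.piecewise z.1 z.2)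
      ((Measure.pi fun _ => μ).prod (Measure.pi fun _ => μ)) (Measure.pi fun _ => μ) := by
  refine ⟨measurable_piecewise J, (Measure.pi_eq fun s hs => ?_).symm⟩
  have hpreimage : (fun z : (ι → S) × (ι → S) => J.piecewise z.1 z.2) ⁻¹' Set.univ.pi s =
      (Set.univ.pi fun l => if l ∈ J then s l else Set.univ) ×ˢ
        (Set.univ.pi fun l => if l ∈ J then Set.univ else s l) := by
    ext z
    simp only [Set.mem_preimage, Set.mem_univ_pi, Set.mem_prod, ← forall_and]
    refine forall_congr' fun l => ?_
    by_cases hl : l ∈ J <;> simp [hl]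
  rw [Measure.map_apply (measurable_piecewise J) (MeasurableSet.univ_pi hs), hpreimage,
    Measure.prod_prod, Measure.pi_pi, Measure.pi_pi, ← Finset.prod_mul_distrib]
  refine Finset.prod_congr rfl fun l _ => ?_
  by_cases hl : l ∈ J <;> simp [hl]

variable {μ : Measure S} [SigmaFinite μ]

lemma measurePreserving_snoc (m : ℕ) :
    MeasurePreserving (fun z : (Fin m → S) × S => Fin.snoc (α := fun _ => S) z.1 z.2)
      ((Measure.pi fun _ => μ).prod μ) (Measure.pi fun _ => μ) := by
  have hswap := (measurePreserving_piFinSuccAbove (fun _ : Fin (m + 1) => μ) (Fin.last m)).symm.comp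
    (Measure.measurePreserving_swap (μ := Measure.pi fun _ : Fin m => μ) (ν := μ))
  convert hswap using 1
  ext z l
  simp [MeasurableEquiv.piFinSuccAbove]

variable {T : Type*} [MeasurableSpace T] {ν : Measure T} [SFinite ν]

lemma measurePreserving_snoc_assoc (m : ℕ) :
    MeasurePreserving
      (fun z : (Fin m → S) × S × T =>
        ((Fin.snoc (α := fun _ => S) z.1 z.2.1 : Fin (m + 1) → S), z.2.2))
      ((Measure.pi fun _ => μ).prod (μ.prod ν)) ((Measure.pi fun _ => μ).prod ν) :=
  ((measurePreserving_snoc m).prod (MeasurePreserving.id ν)).comp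
    (measurePreserving_prodAssoc (Measure.pi fun _ : Fin m => μ) μ ν).symm

lemma measurePreserving_snoc_left (m : ℕ) :
    MeasurePreserving
      (fun z : S × (Fin m → S) × T =>
        ((Fin.snoc (α := fun _ => S) z.2.1 z.1 : Fin (m + 1) → S), z.2.2))
      (μ.prod ((Measure.pi fun _ => μ).prod ν)) ((Measure.pi fun _ => μ).prod ν) :=
  (((measurePreserving_snoc m).comp Measure.measurePreserving_swap).prod
    (MeasurePreserving.id ν)).comp
      (measurePreserving_prodAssoc μ (Measure.pi fun _ : Fin m => μ) ν).symm

end Product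

lemma IsIID.measurePreserving_of_injective {Ω S : Type*} [MeasurableSpace Ω] [MeasurableSpace S]
    {P : Measure Ω} [IsProbabilityMeasure P] {ξ : ℕ → Ω → S} (hξ : IsIID P ξ) {ι : Type*}
    [Fintype ι] {i : ι → ℕ} (hi : Function.Injective i) :
    MeasurePreserving (fun ω l => ξ (i l) ω) P (Measure.pi fun _ => P.map (ξ 0)) := by
  refine ⟨measurable_pi_iff.2 fun l => hξ.measurable _, ?_⟩
  rw [(iIndepFun_iff_map_fun_eq_pi_map fun l => (hξ.measurable (i l)).aemeasurable).1
    (hξ.indep.precomp hi)]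
  simp only [hξ.map_eq]

/-! ### Tail integrals -/

section Tail

variable {Ω : Type*} [MeasurableSpace Ω] {P : Measure Ω}

lemma lintegral_comp_mul_left_of_pos (F : ℝ → ℝ≥0∞) {c : ℝ} (hc : 0 < c) :
    ∫⁻ u, F (c * u) = ENNReal.ofReal c⁻¹ * ∫⁻ u, F u := by
  have hmap : Measure.map (MeasurableEquiv.mulLeft₀ c hc.ne') volume =
      ENNReal.ofReal |c⁻¹| • (volume : Measure ℝ) := Real.map_volume_mul_left hc.ne'
  have hequiv := lintegral_map_equiv (μ := volume) F (MeasurableEquiv.mulLeft₀ c hc.ne')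
  rw [hmap, lintegral_smul_measure, abs_of_pos (inv_pos.2 hc)] at hequiv
  exact hequiv.symm

lemma tailIntegral_mul_le (Y : Ω → ℝ≥0∞) {q t c : ℝ} (hc : 0 < c) (hc1 : c ≤ 1) :
    tailIntegral P Y q (c * t) ≤ ENNReal.ofReal (c ^ (-q)) * tailIntegral P Y q t := by
  set F : ℝ → ℝ≥0∞ := (Set.Ioc (0 : ℝ) 1).indicator
    fun u => ENNReal.ofReal (u ^ (q - 1)) * P {ω | ENNReal.ofReal (t * u) < Y ω} with hF
  have hFint : tailIntegral P Y q t = ∫⁻ u, F u := by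
    rw [hF, lintegral_indicator measurableSet_Ioc, tailIntegral]
  have hscale : ∀ u ∈ Set.Ioc (0 : ℝ) 1,
      ENNReal.ofReal (u ^ (q - 1)) * P {ω | ENNReal.ofReal (c * t * u) < Y ω} =
        ENNReal.ofReal (c ^ (1 - q)) * F (c * u) := by
    intro u hu
    have hcu : c * u ∈ Set.Ioc (0 : ℝ) 1 := ⟨mul_pos hc hu.1, mul_le_one₀ hc1 hu.1.le hu.2⟩
    rw [hF, Set.indicator_of_mem hcu, ← mul_assoc, ← ENNReal.ofReal_mul (by positivity),
      Real.mul_rpow hc.le hu.1.le, ← mul_assoc, ← Real.rpow_add hc, mul_left_comm t, mul_assoc c]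
    simp
  calc tailIntegral P Y q (c * t)
      = ∫⁻ u in Set.Ioc (0 : ℝ) 1, ENNReal.ofReal (c ^ (1 - q)) * F (c * u) :=
        setLIntegral_congr_fun measurableSet_Ioc hscale
    _ ≤ ∫⁻ u, ENNReal.ofReal (c ^ (1 - q)) * F (c * u) := setLIntegral_le_lintegral _ _
    _ = ENNReal.ofReal (c ^ (1 - q)) * (ENNReal.ofReal c⁻¹ * ∫⁻ u, F u) := by
        rw [lintegral_const_mul' _ _ (by simp), lintegral_comp_mul_left_of_pos F hc]
    _ = ENNReal.ofReal (c ^ (-q)) * tailIntegral P Y q t := by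
        rw [hFint, ← mul_assoc, ← ENNReal.ofReal_mul (by positivity), ← Real.rpow_neg_one c,
          ← Real.rpow_add hc]
        ring_nf

lemma setLIntegral_Ioc_rpow {q a : ℝ} (hq : 0 < q) (ha : 0 ≤ a) :
    ∫⁻ u in Set.Ioc (0 : ℝ) a, ENNReal.ofReal (u ^ (q - 1)) = ENNReal.ofReal (a ^ q / q) := by
  have hint : IntervalIntegrable (fun u : ℝ => u ^ (q - 1)) volume 0 a :=
    intervalIntegral.intervalIntegrable_rpow' (by linarith)
  have hnonneg : ∀ᵐ u ∂volume.restrict (Set.Ioc 0 a), 0 ≤ u ^ (q - 1) :=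
    ae_restrict_of_forall_mem measurableSet_Ioc fun u hu => Real.rpow_nonneg hu.1.le _
  rw [← ofReal_integral_eq_lintegral_ofReal ((intervalIntegrable_iff_integrableOn_Ioc_of_le ha).1
      hint) hnonneg, ← intervalIntegral.integral_of_le ha, integral_rpow (Or.inl (by linarith))]
  simp [Real.zero_rpow hq.ne']

lemma one_le_mul_tailIntegral [IsProbabilityMeasure P] {Y : Ω → ℝ≥0∞} {q t : ℝ} (hq : 0 < q)
    (ht : 0 ≤ t) (hY : ∀ ω, ENNReal.ofReal t < Y ω) :
    1 ≤ ENNReal.ofReal q * tailIntegral P Y q t := by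
  have htail : tailIntegral P Y q t = ∫⁻ u in Set.Ioc (0 : ℝ) 1, ENNReal.ofReal (u ^ (q - 1)) := by
    refine setLIntegral_congr_fun measurableSet_Ioc fun u hu => ?_
    have huniv : {ω | ENNReal.ofReal (t * u) < Y ω} = Set.univ := Set.eq_univ_of_forall fun ω =>
      (ENNReal.ofReal_le_ofReal (mul_le_of_le_one_right ht hu.2)).trans_lt (hY ω)
    simp [huniv]
  rw [htail, setLIntegral_Ioc_rpow hq zero_le_one, ← ENNReal.ofReal_mul hq.le]
  simp [hq.ne']

lemma tailIntegral_const_le [IsProbabilityMeasure P] (A : ℝ≥0∞) {q t : ℝ} (hq : 0 < q)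
    (ht : 0 < t) :
    tailIntegral P (fun _ => A) q t ≤
      ENNReal.ofReal (1 / q) * (ENNReal.ofReal (t ^ (-q)) * A ^ q) := by
  induction A with
  | top =>
    have hpos : 0 < t ^ (-q) := Real.rpow_pos_of_pos ht _
    rw [ENNReal.top_rpow_of_pos hq, ENNReal.mul_top (by simpa using hpos),
      ENNReal.mul_top (by simpa using hq)]
    exact le_top
  | coe A =>
  have hbound : ∀ u ∈ Set.Ioc (0 : ℝ) 1,
      ENNReal.ofReal (u ^ (q - 1)) * P {_ω : Ω | ENNReal.ofReal (t * u) < (A : ℝ≥0∞)} ≤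
        (Set.Ioc (0 : ℝ) (A / t)).indicator (fun u => ENNReal.ofReal (u ^ (q - 1))) u := by
    intro u hu
    by_cases h : ENNReal.ofReal (t * u) < (A : ℝ≥0∞)
    · have huA : u ∈ Set.Ioc (0 : ℝ) (A / t) := by
        refine ⟨hu.1, (le_div_iff₀' ht).2 ?_⟩
        exact ((ENNReal.ofReal_lt_iff_lt_toReal (mul_pos ht hu.1).le (by simp)).1 h).le
      rw [Set.indicator_of_mem huA]
      exact mul_le_of_le_one_right' prob_le_one
    · simp [h]
  calc tailIntegral P (fun _ => (A : ℝ≥0∞)) q t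
      ≤ ∫⁻ u in Set.Ioc (0 : ℝ) 1,
          (Set.Ioc (0 : ℝ) (A / t)).indicator (fun u => ENNReal.ofReal (u ^ (q - 1))) u :=
        setLIntegral_mono' measurableSet_Ioc hbound
    _ ≤ ∫⁻ u, (Set.Ioc (0 : ℝ) (A / t)).indicator (fun u => ENNReal.ofReal (u ^ (q - 1))) u :=
        setLIntegral_le_lintegral _ _
    _ = ENNReal.ofReal ((A / t : ℝ) ^ q / q) := by
        rw [lintegral_indicator measurableSet_Ioc, setLIntegral_Ioc_rpow hq (by positivity)]
    _ = ENNReal.ofReal (1 / q) * (ENNReal.ofReal (t ^ (-q)) * (A : ℝ≥0∞) ^ q) := by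
        rw [← ENNReal.ofReal_coe_nnreal, ENNReal.ofReal_rpow_of_nonneg A.coe_nonneg hq.le,
          ← ENNReal.ofReal_mul (by positivity), ← ENNReal.ofReal_mul (by positivity),
          Real.div_rpow A.coe_nonneg ht.le, Real.rpow_neg ht.le]
        congr 1
        field_simp

lemma tailIntegral_comp {Ω' : Type*} [MeasurableSpace Ω'] {P' : Measure Ω'} {X : Ω → Ω'}
    (hX : MeasurePreserving X P P') {Y : Ω' → ℝ≥0∞} (hY : Measurable Y) (q t : ℝ) :
    tailIntegral P (fun ω => Y (X ω)) q t = tailIntegral P' Y q t :=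
  lintegral_congr fun _ => congrArg _ <|
    hX.measure_preimage (measurableSet_lt measurable_const hY).nullMeasurableSet

lemma tailIntegral_congr_ae {Y Y' : Ω → ℝ≥0∞} (h : Y =ᵐ[P] Y') (q t : ℝ) :
    tailIntegral P Y q t = tailIntegral P Y' q t := by
  refine lintegral_congr fun u => congrArg _ (measure_congr ?_)
  filter_upwards [h] with ω hω
  exact congrArg (ENNReal.ofReal (t * u) < ·) hω

lemma tailIntegral_const_mul {a : ℝ} (ha : 0 < a) (Y : Ω → ℝ≥0∞) (q t : ℝ) :
    tailIntegral P (fun ω => ENNReal.ofReal a * Y ω) q t = tailIntegral P Y q (t * a⁻¹) := by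
  refine lintegral_congr fun u => ?_
  have hsplit : ENNReal.ofReal (t * u) = ENNReal.ofReal a * ENNReal.ofReal (t * a⁻¹ * u) := by
    rw [← ENNReal.ofReal_mul ha.le]
    congr 1
    field_simp
  simp only [hsplit, ENNReal.mul_lt_mul_iff_right (ENNReal.ofReal_pos.2 ha).ne'
    ENNReal.ofReal_ne_top]

section Param

variable {S : Type*} [MeasurableSpace S] [SFinite P] {Y : S × Ω → ℝ≥0∞}

lemma measurable_tailIntegral_integrand (hY : Measurable Y) (q t : ℝ) :
    Measurable fun z : S × ℝ =>
      ENNReal.ofReal (z.2 ^ (q - 1)) * P {ω | ENNReal.ofReal (t * z.2) < Y (z.1, ω)} := by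
  have hset : MeasurableSet {z : (S × ℝ) × Ω | ENNReal.ofReal (t * z.1.2) < Y (z.1.1, z.2)} :=
    measurableSet_lt (by fun_prop) (hY.comp (by fun_prop))
  exact Measurable.mul (by fun_prop) (measurable_measure_prodMk_left hset)

lemma measurable_tailIntegral (hY : Measurable Y) (q t : ℝ) :
    Measurable fun x => tailIntegral P (fun ω => Y (x, ω)) q t :=
  (measurable_tailIntegral_integrand hY q t).lintegral_prod_right'

lemma lintegral_tailIntegral {μ : Measure S} [SFinite μ] (hY : Measurable Y) (q t : ℝ) :
    ∫⁻ x, tailIntegral P (fun ω => Y (x, ω)) q t ∂μ = tailIntegral (μ.prod P) Y q t := by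
  simp only [tailIntegral]
  rw [lintegral_lintegral_swap (measurable_tailIntegral_integrand hY q t).aemeasurable]
  refine lintegral_congr fun u => ?_
  rw [lintegral_const_mul' _ _ ENNReal.ofReal_ne_top,
    Measure.prod_apply (measurableSet_lt measurable_const hY)]
  rfl

end Param

end Tail

/-! ### The tail functional of a kernel -/

/-- The kernel in the first `m` variables obtained by fixing the last variable to be `x`. -/
def freezeLast {S T B : Type*} {m : ℕ} (h : (Fin (m + 1) → S) → T → B) (x : S) :
    (Fin m → S) → T → B :=
  fun y τ => h (Fin.snoc (α := fun _ => S) y x) τ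

/-- The kernel in the first `m` variables obtained by moving the last variable to the parameter
space. -/
def absorbLast {S T B : Type*} {m : ℕ} (h : (Fin (m + 1) → S) → T → B) :
    (Fin m → S) → S × T → B :=
  fun y z => h (Fin.snoc (α := fun _ => S) y z.1) z.2

section Snoc

variable {S : Type*} {m : ℕ}

lemma piecewise_insert_last_snoc (J : Finset (Fin m)) (y z : Fin m → S) (x w : S) :
    (insert (Fin.last m) (J.map Fin.castSuccEmb)).piecewise
      (Fin.snoc (α := fun _ => S) y x) (Fin.snoc (α := fun _ => S) z w) =
      Fin.snoc (α := fun _ => S) (J.piecewise y z) x := by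
  ext l
  induction l using Fin.lastCases <;> simp [Finset.piecewise]

lemma piecewise_map_castSucc_snoc (J : Finset (Fin m)) (y z : Fin m → S) (x w : S) :
    (J.map Fin.castSuccEmb).piecewise
      (Fin.snoc (α := fun _ => S) y x) (Fin.snoc (α := fun _ => S) z w) =
      Fin.snoc (α := fun _ => S) (J.piecewise y z) w := by
  ext l
  induction l using Fin.lastCases <;> simp [Finset.piecewise]

variable {T B : Type*} [MeasurableSpace S] [MeasurableSpace T] [MeasurableSpace B]
  {h : (Fin (m + 1) → S) → T → B}

lemma measurable_freezeLast (hh : Measurable (Function.uncurry h)) (x : S) :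
    Measurable (Function.uncurry (freezeLast h x)) :=
  hh.comp (((measurable_snoc m).comp (measurable_fst.prodMk measurable_const)).prodMk
    measurable_snd)

lemma measurable_absorbLast (hh : Measurable (Function.uncurry h)) :
    Measurable (Function.uncurry (absorbLast h)) :=
  hh.comp (((measurable_snoc m).comp
    (measurable_fst.prodMk (measurable_fst.comp measurable_snd))).prodMk
      (measurable_snd.comp measurable_snd))

end Snoc

section Kernel

variable {S T B : Type*} [MeasurableSpace S] [MeasurableSpace T] [NormedAddCommGroup B]

/-- The conditional `L^p` norm of the kernel `h` given that the variables with index in `J` have the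
values prescribed by `y`; the other variables and the parameter are integrated out. -/
def condLpNorm {m : ℕ} (p : ℝ) (μ : Measure S) (ν : Measure T) (h : (Fin m → S) → T → B)
    (J : Finset (Fin m)) (y : Fin m → S) : ℝ≥0∞ :=
  (∫⁻ z, ∫⁻ τ, ‖h (J.piecewise y z) τ‖ₑ ^ p ∂ν ∂(Measure.pi fun _ => μ)) ^ (1 / p)

/-- The right-hand side of the deviation inequality for the kernel `h`, up to a constant factor. The
summand `J = univ` is the first term of that inequality and `J = ∅` bounds the last one. -/
def tailBound {m : ℕ} (p q : ℝ) (μ : Measure S) (ν : Measure T) (h : (Fin m → S) → T → B)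
    (N : ℕ) (t : ℝ) : ℝ≥0∞ :=
  ∑ J : Finset (Fin m), (N : ℝ≥0∞) ^ J.card *
    tailIntegral (Measure.pi fun _ => μ)
      (fun y => (N : ℝ≥0∞) ^ (((m : ℝ) - (J.card : ℝ)) / p) * condLpNorm p μ ν h J y) q t

/-- The kernel `h` is degenerate: its integral over any single variable exists and vanishes, for
almost all values of the other variables and of the parameter. -/
def DegenerateKernel [NormedSpace ℝ B] {m : ℕ} (μ : Measure S) (ν : Measure T)
    (h : (Fin m → S) → T → B) : Prop :=
  ∀ l, ∀ᵐ z ∂((Measure.pi fun _ => μ).prod ν),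
    Integrable (fun x => h (Function.update z.1 l x) z.2) μ ∧
      ∫ x, h (Function.update z.1 l x) z.2 ∂μ = 0

variable {μ : Measure S} {ν : Measure T} {p q : ℝ} {m : ℕ}

lemma tailBound_mul_le (h : (Fin m → S) → T → B) (N : ℕ) {t c : ℝ} (hc : 0 < c) (hc1 : c ≤ 1) :
    tailBound p q μ ν h N (c * t) ≤ ENNReal.ofReal (c ^ (-q)) * tailBound p q μ ν h N t := by
  simp only [tailBound, Finset.mul_sum, mul_left_comm (ENNReal.ofReal _)]
  gcongr
  exact tailIntegral_mul_le _ hc hc1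

lemma lintegral_pi_succ [SigmaFinite μ] {F : (Fin (m + 1) → S) → ℝ≥0∞} (hF : Measurable F) :
    ∫⁻ z, F z ∂(Measure.pi fun _ => μ) =
      ∫⁻ z, ∫⁻ w, F (Fin.snoc (α := fun _ => S) z w) ∂μ ∂(Measure.pi fun _ => μ) := by
  rw [← (measurePreserving_snoc (μ := μ) m).lintegral_comp hF,
    lintegral_prod (fun z : (Fin m → S) × S => F (Fin.snoc (α := fun _ => S) z.1 z.2))
      (hF.comp (measurable_snoc m)).aemeasurable]

section Recursion

variable [MeasurableSpace B] [OpensMeasurableSpace B] [SFinite ν]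

lemma measurable_lintegral_piecewise {h : (Fin m → S) → T → B}
    (hh : Measurable (Function.uncurry h)) (J : Finset (Fin m)) :
    Measurable fun z : (Fin m → S) × (Fin m → S) =>
      ∫⁻ τ, ‖h (J.piecewise z.1 z.2) τ‖ₑ ^ p ∂ν :=
  ((hh.comp (((measurable_piecewise J).comp measurable_fst).prodMk
    measurable_snd)).enorm.pow_const p).lintegral_prod_right'

lemma measurable_condLpNorm [SigmaFinite μ] {h : (Fin m → S) → T → B}
    (hh : Measurable (Function.uncurry h)) (J : Finset (Fin m)) :
    Measurable (condLpNorm p μ ν h J) :=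
  (measurable_lintegral_piecewise hh J).lintegral_prod_right'.pow_const _

variable {h : (Fin (m + 1) → S) → T → B}

section SigmaFinite

variable [SigmaFinite μ]

lemma condLpNorm_succ (hh : Measurable (Function.uncurry h)) (J : Finset (Fin (m + 1)))
    (y : Fin (m + 1) → S) :
    condLpNorm p μ ν h J y = (∫⁻ z, ∫⁻ w, ∫⁻ τ,
      ‖h (J.piecewise y (Fin.snoc (α := fun _ => S) z w)) τ‖ₑ ^ p ∂ν ∂μ
        ∂(Measure.pi fun _ => μ)) ^ (1 / p) :=
  congrArg (· ^ (1 / p))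
    (lintegral_pi_succ ((measurable_lintegral_piecewise hh J).comp measurable_prodMk_left))

lemma condLpNorm_map_castSucc (hh : Measurable (Function.uncurry h)) (J : Finset (Fin m))
    (y : Fin m → S) (x : S) :
    condLpNorm p μ ν h (J.map Fin.castSuccEmb) (Fin.snoc (α := fun _ => S) y x) =
      condLpNorm p μ (μ.prod ν) (absorbLast h) J y := by
  rw [condLpNorm_succ hh, condLpNorm]
  congr 1
  refine lintegral_congr fun z => ?_
  have hmeas : Measurable fun w => ‖absorbLast h (J.piecewise y z) w‖ₑ ^ p :=
    ((measurable_absorbLast hh).comp measurable_prodMk_left).enorm.pow_const p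
  rw [lintegral_prod _ hmeas.aemeasurable]
  simp only [piecewise_map_castSucc_snoc, absorbLast]

end SigmaFinite

variable [IsProbabilityMeasure μ]

lemma condLpNorm_insert_last (hh : Measurable (Function.uncurry h)) (J : Finset (Fin m))
    (y : Fin m → S) (x : S) :
    condLpNorm p μ ν h (insert (Fin.last m) (J.map Fin.castSuccEmb))
      (Fin.snoc (α := fun _ => S) y x) = condLpNorm p μ ν (freezeLast h x) J y := by
  rw [condLpNorm_succ hh]
  simp [piecewise_insert_last_snoc, condLpNorm, freezeLast]

lemma measurable_condLpNorm_freezeLast (hh : Measurable (Function.uncurry h))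
    (J : Finset (Fin m)) :
    Measurable fun z : S × (Fin m → S) => condLpNorm p μ ν (freezeLast h z.1) J z.2 := by
  simp only [← condLpNorm_insert_last hh]
  exact (measurable_condLpNorm hh _).comp ((measurable_snoc m).comp measurable_swap)

lemma tailIntegral_condLpNorm_map_castSucc (hh : Measurable (Function.uncurry h))
    (J : Finset (Fin m)) (a : ℝ≥0∞) (t : ℝ) :
    tailIntegral (Measure.pi fun _ => μ)
        (fun y => a * condLpNorm p μ ν h (J.map Fin.castSuccEmb) y) q t =
      tailIntegral (Measure.pi fun _ => μ)
        (fun y => a * condLpNorm p μ (μ.prod ν) (absorbLast h) J y) q t := by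
  rw [← tailIntegral_comp (measurePreserving_snoc (μ := μ) m)
      ((measurable_condLpNorm hh _).const_mul a),
    ← tailIntegral_comp (measurePreserving_fst (μ := Measure.pi fun _ : Fin m => μ) (ν := μ))
      ((measurable_condLpNorm (measurable_absorbLast hh) J).const_mul a)]
  simp only [condLpNorm_map_castSucc hh]

lemma tailIntegral_condLpNorm_insert_last (hh : Measurable (Function.uncurry h))
    (J : Finset (Fin m)) (a : ℝ≥0∞) (t : ℝ) :
    tailIntegral (Measure.pi fun _ => μ)
        (fun y => a * condLpNorm p μ ν h (insert (Fin.last m) (J.map Fin.castSuccEmb)) y) q t =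
      ∫⁻ x, tailIntegral (Measure.pi fun _ => μ)
        (fun y => a * condLpNorm p μ ν (freezeLast h x) J y) q t ∂μ := by
  rw [← tailIntegral_comp ((measurePreserving_snoc (μ := μ) m).comp Measure.measurePreserving_swap)
      ((measurable_condLpNorm hh _).const_mul a),
    lintegral_tailIntegral (Y := fun z : S × (Fin m → S) =>
      a * condLpNorm p μ ν (freezeLast h z.1) J z.2)
      ((measurable_condLpNorm_freezeLast hh J).const_mul a)]
  simp only [Function.comp_apply, Prod.fst_swap, Prod.snd_swap, condLpNorm_insert_last hh]

lemma sum_tailIntegral_map_castSucc (hh : Measurable (Function.uncurry h)) {N : ℕ} (hN : N ≠ 0)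
    (t : ℝ) :
    ∑ J : Finset (Fin m), (N : ℝ≥0∞) ^ (J.map Fin.castSuccEmb).card *
        tailIntegral (Measure.pi fun _ => μ)
          (fun y => (N : ℝ≥0∞) ^ (((m + 1 : ℕ) - (J.map Fin.castSuccEmb).card : ℝ) / p) *
            condLpNorm p μ ν h (J.map Fin.castSuccEmb) y) q t =
      tailBound p q μ (μ.prod ν) (absorbLast h) N (t * ((N : ℝ) ^ (1 / p))⁻¹) := by
  have hN0 : (0 : ℝ) < N := by positivity
  refine Finset.sum_congr rfl fun J _ => ?_
  have hexponent : (N : ℝ≥0∞) ^ (((m + 1 : ℕ) - (J.card : ℝ)) / p) =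
      ENNReal.ofReal ((N : ℝ) ^ (1 / p)) * (N : ℝ≥0∞) ^ ((m - (J.card : ℝ)) / p) := by
    rw [← ENNReal.ofReal_rpow_of_pos hN0, ENNReal.ofReal_natCast,
      ← ENNReal.rpow_add _ _ (Nat.cast_ne_zero.2 hN) (ENNReal.natCast_ne_top N)]
    congr 1
    push_cast
    ring
  rw [Finset.card_map, ← tailIntegral_const_mul (by positivity),
    tailIntegral_condLpNorm_map_castSucc hh, hexponent]
  simp only [mul_assoc]

lemma sum_tailIntegral_insert_last (hh : Measurable (Function.uncurry h)) (N : ℕ) (t : ℝ) :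
    ∑ J : Finset (Fin m), (N : ℝ≥0∞) ^ (insert (Fin.last m) (J.map Fin.castSuccEmb)).card *
        tailIntegral (Measure.pi fun _ => μ)
          (fun y => (N : ℝ≥0∞) ^
              (((m + 1 : ℕ) - (insert (Fin.last m) (J.map Fin.castSuccEmb)).card : ℝ) / p) *
            condLpNorm p μ ν h (insert (Fin.last m) (J.map Fin.castSuccEmb)) y) q t =
      N * ∫⁻ x, tailBound p q μ ν (freezeLast h x) N t ∂μ := by
  have hmeas (a : ℝ≥0∞) (J : Finset (Fin m)) :
      Measurable fun x => tailIntegral (Measure.pi fun _ => μ)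
        (fun y => a * condLpNorm p μ ν (freezeLast h x) J y) q t :=
    measurable_tailIntegral (Y := fun z : S × (Fin m → S) =>
      a * condLpNorm p μ ν (freezeLast h z.1) J z.2)
      ((measurable_condLpNorm_freezeLast hh J).const_mul _) q t
  simp only [tailBound]
  rw [lintegral_finsetSum _ fun J _ => (hmeas _ J).const_mul _, Finset.mul_sum]
  refine Finset.sum_congr rfl fun J _ => ?_
  rw [lintegral_const_mul _ (hmeas _ J), tailIntegral_condLpNorm_insert_last hh,
    Finset.card_insert_of_notMem (by simp), Finset.card_map, ← mul_assoc, ← pow_succ']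
  push_cast
  rw [add_sub_add_right_eq_sub]

lemma tailBound_succ (hh : Measurable (Function.uncurry h)) {N : ℕ} (hN : N ≠ 0) (t : ℝ) :
    tailBound p q μ ν h N t =
      tailBound p q μ (μ.prod ν) (absorbLast h) N (t * ((N : ℝ) ^ (1 / p))⁻¹) +
        N * ∫⁻ x, tailBound p q μ ν (freezeLast h x) N t ∂μ := by
  rw [tailBound, sum_finset_fin_succ, sum_tailIntegral_map_castSucc hh hN,
    sum_tailIntegral_insert_last hh]

end Recursion

section Degenerate

variable [NormedSpace ℝ B] [SFinite ν] {h : (Fin (m + 1) → S) → T → B}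

lemma DegenerateKernel.freezeLast [SigmaFinite μ] (hd : DegenerateKernel μ ν h) :
    ∀ᵐ x ∂μ, DegenerateKernel μ ν (freezeLast h x) := by
  refine ae_all_iff.2 fun l => ?_
  filter_upwards [Measure.ae_ae_of_ae_prod
    ((measurePreserving_snoc_left m).quasiMeasurePreserving.ae (hd l.castSucc))] with x hx
  simpa only [_root_.freezeLast, Fin.snoc_update] using hx

lemma DegenerateKernel.absorbLast [SigmaFinite μ] (hd : DegenerateKernel μ ν h) :
    DegenerateKernel μ (μ.prod ν) (absorbLast h) := fun l => by
  simpa only [_root_.absorbLast, Fin.snoc_update] using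
    (measurePreserving_snoc_assoc m).quasiMeasurePreserving.ae (hd l.castSucc)

lemma DegenerateKernel.ae_integral_snoc [IsProbabilityMeasure μ] (hd : DegenerateKernel μ ν h) :
    ∀ᵐ z ∂((Measure.pi fun _ => μ).prod ν),
      Integrable (fun x => h (Fin.snoc (α := fun _ => S) z.1 x) z.2) μ ∧
        ∫ x, h (Fin.snoc (α := fun _ => S) z.1 x) z.2 ∂μ = 0 := by
  obtain ⟨x, hx⟩ := (Measure.ae_ae_of_ae_prod
    ((measurePreserving_snoc_left m).quasiMeasurePreserving.ae (hd (Fin.last m)))).exists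
  simpa only [Fin.update_snoc_last] using hx

end Degenerate

end Kernel

/-! ### The deviation inequality for degenerate kernels -/

lemma le_two_mul_of_recursive_le {F H : ℝ → ℝ≥0∞} {ε a b : ℝ≥0∞} (hF1 : ∀ t, F t ≤ 1)
    (hF : ∀ t, 0 < t → F t ≤ ε * F (t / 2) + a * H t) (hH : ∀ t, 0 < t → H (t / 2) ≤ b * H t)
    (hε : ε ≤ 2⁻¹) (hεb : ε * b ≤ 2⁻¹) {t : ℝ} (ht : 0 < t) : F t ≤ 2 * a * H t := by
  have hiterate : ∀ j : ℕ, ∀ t, 0 < t → F t ≤ 2 * a * H t + 2⁻¹ ^ j := by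
    intro j
    induction j with
    | zero => exact fun t _ => by simpa using (hF1 t).trans le_add_self
    | succ j ih =>
      intro t ht
      calc F t ≤ ε * F (t / 2) + a * H t := hF t ht
        _ ≤ ε * (2 * a * (b * H t) + 2⁻¹ ^ j) + a * H t := by
          gcongr
          refine (ih (t / 2) (half_pos ht)).trans ?_
          gcongr
          exact hH t ht
        _ = (ε * b) * (2 * (a * H t)) + ε * 2⁻¹ ^ j + a * H t := by ring
        _ ≤ 2⁻¹ * (2 * (a * H t)) + 2⁻¹ * 2⁻¹ ^ j + a * H t := by gcongr
        _ = 2 * a * H t + 2⁻¹ ^ (j + 1) := by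
          rw [← mul_assoc, ENNReal.inv_mul_cancel (by simp) (by simp), one_mul, pow_succ']
          ring
  have hlim : Filter.Tendsto (fun j : ℕ => 2 * a * H t + (2⁻¹ : ℝ≥0∞) ^ j) Filter.atTop
      (nhds (2 * a * H t)) := by
    simpa using (ENNReal.tendsto_pow_atTop_nhds_zero_of_lt_one
      ENNReal.one_half_lt_one).const_add (2 * a * H t)
  exact ge_of_tendsto' hlim fun j => hiterate j t ht

lemma exists_lt_of_lt_sum {V : ℕ → ℝ≥0∞} {N : ℕ} {v : ℝ≥0∞}
    (h : v < ∑ k ∈ Finset.range N, V k) : ∃ k < N, v < N * V k := by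
  by_contra! hle
  have hN : N ≠ 0 := by
    rintro rfl
    simp at h
  have hsum : (N : ℝ≥0∞) * ∑ k ∈ Finset.range N, V k ≤ N * v := by
    rw [Finset.mul_sum]
    exact (Finset.sum_le_sum fun k hk => hle k (Finset.mem_range.1 hk)).trans_eq (by simp)
  exact h.not_ge ((ENNReal.mul_le_mul_iff_right (Nat.cast_ne_zero.2 hN)
    (ENNReal.natCast_ne_top N)).1 hsum)

/-- The increment `uStat (k + 1) - uStat k` of the `U`-statistic with kernel `h`, as a function of
the past, of the fresh variable `x` and of the parameter. -/
def uIncrement {Ω S T B : Type*} [AddCommMonoid B] {m : ℕ} (ξ : ℕ → Ω → S)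
    (h : (Fin (m + 1) → S) → T → B) (k : ℕ) (ω : Ω) (x : S) (τ : T) : B :=
  uStat ξ (fun y => freezeLast h x y τ) k ω

/-- The probability that for some `n ≤ N` the `L^p(ν)` norm, in the parameter, of the `n`-th
`U`-statistic with kernel `h` exceeds `t`. -/
def maxTail {Ω S T B : Type*} [MeasurableSpace Ω] [MeasurableSpace T] [NormedAddCommGroup B] {m : ℕ}
    (p : ℝ) (P : Measure Ω) (ν : Measure T) (ξ : ℕ → Ω → S) (h : (Fin m → S) → T → B)
    (N : ℕ) (t : ℝ) : ℝ≥0∞ :=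
  P {ω | ∃ n ≤ N, ENNReal.ofReal t < eLpNorm' (fun τ => uStat ξ (fun y => h y τ) n ω) p ν}

section Increments

variable {Ω S T B : Type*} [mT : MeasurableSpace T] [NormedAddCommGroup B] {ξ : ℕ → Ω → S}
  {ν : Measure T} {p : ℝ} {m : ℕ} {h : (Fin (m + 1) → S) → T → B}

lemma maxTail_eq_measure_partialSumNorm [MeasurableSpace Ω] {P : Measure Ω} (N : ℕ) (t : ℝ) :
    maxTail p P ν ξ h N t =
      P {ω | ∃ n ≤ N, ENNReal.ofReal t < partialSumNorm p ν ξ (uIncrement ξ h) n ω} := by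
  simp only [maxTail, uStat_eq_sum_range, partialSumNorm, uIncrement, freezeLast]

variable [mS : MeasurableSpace S]

lemma ae_integral_uIncrement [MeasurableSpace Ω] {P : Measure Ω} [IsProbabilityMeasure P]
    [NormedSpace ℝ B] [SFinite ν] (hξ : IsIID P ξ)
    (hd : DegenerateKernel (P.map (ξ 0)) ν h) (k : ℕ) :
    ∀ᵐ z ∂(P.prod ν), ∫ x, uIncrement ξ h k z.1 x z.2 ∂(P.map (ξ 0)) = 0 := by
  have := hξ.isProbabilityMeasure_map
  have hsummand : ∀ i : Fin m ↪o Fin k, ∀ᵐ z ∂(P.prod ν),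
      Integrable (fun x => freezeLast h x (fun l => ξ (i l) z.1) z.2) (P.map (ξ 0)) ∧
        ∫ x, freezeLast h x (fun l => ξ (i l) z.1) z.2 ∂(P.map (ξ 0)) = 0 := fun i =>
    ((hξ.measurePreserving_of_injective (Fin.val_injective.comp i.injective)).prod
      (MeasurePreserving.id ν)).quasiMeasurePreserving.ae hd.ae_integral_snoc
  filter_upwards [ae_all_iff.2 hsummand] with z hz
  simp only [uIncrement, uStat]
  rw [integral_finsetSum _ fun i _ => (hz i).1]
  exact Finset.sum_eq_zero fun i _ => (hz i).2

variable [TopologicalSpace.SeparableSpace B] [MeasurableSpace B] [BorelSpace B]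

lemma dependsOnPast_uIncrement (hh : Measurable (Function.uncurry h)) :
    DependsOnPast ξ (uIncrement ξ h) := by
  intro k
  refine Finset.measurable_sum _ fun i _ => ?_
  have hpast : Measurable[pastSigma ξ k] fun ω l => ξ (i l) ω :=
    @measurable_pi_lambda _ _ _ (pastSigma ξ k) _ _ fun l => measurable_pastSigma ξ (i l).2
  have hargs : @Measurable (Ω × S × T) ((Fin m → S) × S × T) ((pastSigma ξ k).prod (mS.prod mT)) _
      (fun z => (fun l => ξ (i l) z.1, z.2)) :=
    (hpast.comp measurable_fst).prodMk measurable_snd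
  exact (measurable_absorbLast hh).comp hargs

lemma incrementMoment_uIncrement [SFinite ν] (hp : 0 < p) (hh : Measurable (Function.uncurry h))
    {μ : Measure S} [SFinite μ] (k : ℕ) (ω : Ω) :
    incrementMoment p μ ν (uIncrement ξ h) k ω =
      eLpNorm' (fun z => uStat ξ (fun y => absorbLast h y z) k ω) p (μ.prod ν) ^ p := by
  have hmeas : Measurable fun z => uStat ξ (fun y => absorbLast h y z) k ω :=
    Finset.measurable_sum _ fun i _ => (measurable_absorbLast hh).comp measurable_prodMk_left
  rw [← lintegral_rpow_enorm_eq_rpow_eLpNorm' hp,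
    lintegral_prod _ (hmeas.enorm.pow_const p).aemeasurable]
  rfl

variable [MeasurableSpace Ω] {P : Measure Ω}

lemma measure_lt_sum_incrementMoment_uIncrement_le [SFinite ν] (hp : 0 < p)
    (hh : Measurable (Function.uncurry h)) {μ : Measure S} [SFinite μ] {N : ℕ} (hN : N ≠ 0)
    (v : ℝ) :
    P {ω | ENNReal.ofReal v ^ p <
        ∑ k ∈ Finset.range N, incrementMoment p μ ν (uIncrement ξ h) k ω} ≤
      maxTail p P (μ.prod ν) ξ (absorbLast h) N (v * ((N : ℝ) ^ (1 / p))⁻¹) := by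
  refine measure_mono fun ω hω => ?_
  obtain ⟨k, hk, hlt⟩ := exists_lt_of_lt_sum hω
  refine ⟨k, hk.le, ?_⟩
  have hNp : 0 < (N : ℝ) ^ (1 / p) := by positivity
  have hroot : (N : ℝ≥0∞) = ENNReal.ofReal ((N : ℝ) ^ (1 / p)) ^ p := by
    rw [ENNReal.ofReal_rpow_of_pos hNp, ← Real.rpow_mul N.cast_nonneg, one_div_mul_cancel hp.ne',
      Real.rpow_one, ENNReal.ofReal_natCast]
  have hsplit : ENNReal.ofReal v = ENNReal.ofReal ((N : ℝ) ^ (1 / p)) *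
      ENNReal.ofReal (v * ((N : ℝ) ^ (1 / p))⁻¹) := by
    rw [← ENNReal.ofReal_mul hNp.le, mul_left_comm, mul_inv_cancel₀ hNp.ne', mul_one]
  rwa [incrementMoment_uIncrement hp hh, hroot, ← ENNReal.mul_rpow_of_nonneg _ _ hp.le,
    ENNReal.rpow_lt_rpow_iff hp, hsplit, ENNReal.mul_lt_mul_iff_right (by simpa using hNp)
      ENNReal.ofReal_ne_top] at hlt

variable [IsProbabilityMeasure P]

lemma sum_measure_uIncrement_le [SFinite ν] (hξ : IsIID P ξ)
    (hh : Measurable (Function.uncurry h)) (N : ℕ) (v : ℝ) :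
    ∑ k ∈ Finset.range N,
        P {ω | ENNReal.ofReal v < eLpNorm' (uIncrement ξ h k ω (ξ k ω)) p ν} ≤
      N * ∫⁻ x, maxTail p P ν ξ (freezeLast h x) N v ∂(P.map (ξ 0)) := by
  have hk : ∀ k ∈ Finset.range N,
      P {ω | ENNReal.ofReal v < eLpNorm' (uIncrement ξ h k ω (ξ k ω)) p ν} ≤
        ∫⁻ x, maxTail p P ν ξ (freezeLast h x) N v ∂(P.map (ξ 0)) := by
    intro k hk
    have hmeas : Measurable[(pastSigma ξ k).prod mS]
        fun z : Ω × S => eLpNorm' (uIncrement ξ h k z.1 z.2) p ν :=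
      (measurable_id.pow_const (1 / p)).comp
        ((dependsOnPast_uIncrement hh).measurable_lintegral_enorm k)
    exact (hξ.measure_prodMk_mem (hmeas measurableSet_Ioi)).trans_le (lintegral_mono fun x =>
      measure_mono fun ω hω => ⟨k, (Finset.mem_range.1 hk).le, hω⟩)
  exact (Finset.sum_le_sum hk).trans_eq (by simp)

variable [NormedSpace ℝ B] [CompleteSpace B] {C : ℝ} {φ : B → ℝ}

lemma IsSmoothGauge.maxTail_two_mul_le [SFinite ν] (hφ : IsSmoothGauge p C φ) (hp : 1 ≤ p)
    (hξ : IsIID P ξ) (hh : Measurable (Function.uncurry h))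
    (hd : DegenerateKernel (P.map (ξ 0)) ν h) {N : ℕ} (hN : N ≠ 0) {δ t : ℝ} (hδ0 : 0 < δ)
    (hδ : 2 * δ ≤ 1) (ht : 0 < t) :
    maxTail p P ν ξ h N (2 * t) ≤
      ENNReal.ofReal (C * (2 * δ) ^ p) * maxTail p P ν ξ h N t +
        (N * ∫⁻ x, maxTail p P ν ξ (freezeLast h x) N (δ * t) ∂(P.map (ξ 0)) +
          maxTail p P ((P.map (ξ 0)).prod ν) ξ (absorbLast h) N
            (δ * t * ((N : ℝ) ^ (1 / p))⁻¹)) := by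
  have := hξ.isProbabilityMeasure_map
  have hgood := hφ.good_lambda hp hξ (dependsOnPast_uIncrement hh) (ae_integral_uIncrement hξ hd)
    (t := t.toNNReal) (δ := δ.toNNReal) (by simpa using ht)
    (by rw [← NNReal.coe_le_coe]; simpa [hδ0.le] using hδ) N
  have hδt : (δ.toNNReal : ℝ≥0∞) * (t.toNNReal : ℝ≥0∞) = ENNReal.ofReal (δ * t) :=
    (ENNReal.ofReal_mul hδ0.le).symm
  have h2 (s : ℝ) : 2 * (s.toNNReal : ℝ≥0∞) = ENNReal.ofReal (2 * s) := by
    rw [ENNReal.ofReal_mul zero_le_two, ENNReal.ofReal_ofNat, ENNReal.ofReal]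
  rw [hδt, h2, h2, ENNReal.ofReal_rpow_of_pos (by positivity),
    ← ENNReal.ofReal_mul hφ.const_pos.le] at hgood
  rw [maxTail_eq_measure_partialSumNorm, maxTail_eq_measure_partialSumNorm]
  exact hgood.trans (add_le_add le_rfl (add_le_add (sum_measure_uIncrement_le hξ hh N _)
    (measure_lt_sum_incrementMoment_uIncrement_le (zero_lt_one.trans_le hp) hh hN _)))

lemma IsSmoothGauge.maxTail_two_mul_le_tailBound [SFinite ν] {q : ℝ} (hφ : IsSmoothGauge p C φ)
    (hp : 1 ≤ p) (hξ : IsIID P ξ) (hh : Measurable (Function.uncurry h))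
    (hd : DegenerateKernel (P.map (ξ 0)) ν h) {N : ℕ} (hN : N ≠ 0) {K : ℝ≥0}
    (hfreeze : ∀ᵐ x ∂(P.map (ξ 0)), ∀ v : ℝ, 0 < v →
      maxTail p P ν ξ (freezeLast h x) N v ≤
        K * tailBound p q (P.map (ξ 0)) ν (freezeLast h x) N v)
    (habsorb : ∀ v : ℝ, 0 < v → maxTail p P ((P.map (ξ 0)).prod ν) ξ (absorbLast h) N v ≤
      K * tailBound p q (P.map (ξ 0)) ((P.map (ξ 0)).prod ν) (absorbLast h) N v)
    {δ t : ℝ} (hδ0 : 0 < δ) (hδ : 2 * δ ≤ 1) (ht : 0 < t) :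
    maxTail p P ν ξ h N (2 * t) ≤ ENNReal.ofReal (C * (2 * δ) ^ p) * maxTail p P ν ξ h N t +
      K * tailBound p q (P.map (ξ 0)) ν h N (δ * t) := by
  have := hξ.isProbabilityMeasure_map
  refine (hφ.maxTail_two_mul_le hp hξ hh hd hN hδ0 hδ ht).trans ?_
  rw [tailBound_succ hh hN, mul_add, mul_left_comm, add_comm (N * _ : ℝ≥0∞),
    ← lintegral_const_mul' _ _ ENNReal.coe_ne_top]
  exact add_le_add le_rfl (add_le_add (habsorb _ (by positivity)) (mul_le_mul' le_rfl
    (lintegral_mono_ae (hfreeze.mono fun x hx => hx _ (by positivity)))))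

end Increments

lemma condLpNorm_order_zero {S T B : Type*} [MeasurableSpace S] [MeasurableSpace T]
    [NormedAddCommGroup B] {μ : Measure S} [IsProbabilityMeasure μ] {ν : Measure T} {p : ℝ}
    (h : (Fin 0 → S) → T → B) (J : Finset (Fin 0)) (y : Fin 0 → S) :
    condLpNorm p μ ν h J y = eLpNorm' (h y) p ν := by
  simp [condLpNorm, eLpNorm'_eq_lintegral_enorm, Subsingleton.elim _ y]

lemma maxTail_order_zero_le {Ω S T B : Type*} [MeasurableSpace Ω] [MeasurableSpace S]
    [MeasurableSpace T] [NormedAddCommGroup B] {P : Measure Ω} [IsProbabilityMeasure P]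
    {μ : Measure S} [IsProbabilityMeasure μ] {ν : Measure T} {p q : ℝ} (hq : 0 < q)
    (ξ : ℕ → Ω → S) (h : (Fin 0 → S) → T → B) (N : ℕ) {t : ℝ} (ht : 0 ≤ t) :
    maxTail p P ν ξ h N t ≤ q.toNNReal * tailBound p q μ ν h N t := by
  have htail : tailBound p q μ ν h N t =
      tailIntegral (Measure.pi fun _ => μ) (fun y => eLpNorm' (h y) p ν) q t := by
    simp [tailBound, condLpNorm_order_zero, Finset.eq_empty_of_isEmpty]
  simp only [maxTail, fun n ω τ => uStat_order_zero ξ (fun y => h y τ) n ω Fin.elim0]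
  by_cases hlt : ENNReal.ofReal t < eLpNorm' (h Fin.elim0) p ν
  · rw [htail]
    refine prob_le_one.trans (one_le_mul_tailIntegral hq ht fun y => ?_)
    rwa [Subsingleton.elim y Fin.elim0]
  · simp [hlt]

lemma exists_mul_two_mul_rpow_le {C p ε : ℝ} (hC : 0 < C) (hp : 1 ≤ p) (hε : 0 < ε) :
    ∃ δ : ℝ, 0 < δ ∧ 2 * δ ≤ 1 ∧ C * (2 * δ) ^ p ≤ ε := by
  set s := min 1 (ε / C)
  have hs0 : 0 < s := by positivity
  have hs1 : s ≤ 1 := min_le_left _ _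
  refine ⟨s / 2, half_pos hs0, by linarith, ?_⟩
  rw [mul_div_cancel₀ s two_ne_zero]
  calc C * s ^ p ≤ C * s ^ (1 : ℝ) := by
        gcongr C * ?_
        exact Real.rpow_le_rpow_of_exponent_ge hs0 hs1 hp
    _ ≤ C * (ε / C) := by
        rw [Real.rpow_one]
        gcongr
        exact min_le_right _ _
    _ = ε := mul_div_cancel₀ ε hC.ne'

lemma le_mul_of_two_mul_le {F H : ℝ → ℝ≥0∞} {K : ℝ≥0∞} {ε δ q : ℝ} (hq : 0 ≤ q)
    (hε : ε ≤ 2 ^ (-q) * 2⁻¹) (hε0 : 0 ≤ ε) (hδ0 : 0 < δ) (hδ : 2 * δ ≤ 1) (hF1 : ∀ t, F t ≤ 1)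
    (hF : ∀ t, 0 < t → F (2 * t) ≤ ENNReal.ofReal ε * F t + K * H (δ * t))
    (hH : ∀ c t, 0 < c → c ≤ 1 → H (c * t) ≤ ENNReal.ofReal (c ^ (-q)) * H t) {t : ℝ}
    (ht : 0 < t) : F t ≤ 2 * (K * ENNReal.ofReal ((δ / 2) ^ (-q))) * H t := by
  have hhalf : (2 : ℝ≥0∞)⁻¹ = ENNReal.ofReal 2⁻¹ := by
    rw [ENNReal.ofReal_inv_of_pos two_pos, ENNReal.ofReal_ofNat]
  have h2q : (2 : ℝ) ^ (-q) ≤ 1 := Real.rpow_le_one_of_one_le_of_nonpos one_le_two (by linarith)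
  refine le_two_mul_of_recursive_le (ε := ENNReal.ofReal ε)
    (b := ENNReal.ofReal ((2⁻¹ : ℝ) ^ (-q))) hF1 (fun t ht => ?_) (fun t _ => ?_) ?_ ?_ ht
  · have hstep := hF (t / 2) (half_pos ht)
    rw [mul_div_cancel₀ t two_ne_zero, show δ * (t / 2) = δ / 2 * t by ring] at hstep
    refine hstep.trans ?_
    rw [mul_assoc K]
    gcongr
    exact hH _ t (half_pos hδ0) (by linarith)
  · rw [div_eq_inv_mul]
    exact hH _ t (by norm_num) (by norm_num)
  · rw [hhalf]
    exact ENNReal.ofReal_le_ofReal (hε.trans (by linarith))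
  · rw [hhalf, ← ENNReal.ofReal_mul hε0, Real.inv_rpow zero_le_two]
    refine ENNReal.ofReal_le_ofReal ?_
    rw [← div_eq_mul_inv, div_le_iff₀ (by positivity)]
    linarith

universe u v w

theorem IsSmoothGauge.exists_maxTail_le {B : Type w} [NormedAddCommGroup B] [NormedSpace ℝ B]
    [CompleteSpace B] [TopologicalSpace.SeparableSpace B] [MeasurableSpace B] [BorelSpace B]
    {p q C : ℝ} (hp : 1 ≤ p) (hq : 0 < q) {φ : B → ℝ} (hφ : IsSmoothGauge p C φ) (m : ℕ) :
    ∃ K : ℝ≥0, ∀ (Ω : Type u) (S T : Type v) [MeasurableSpace Ω] [MeasurableSpace S]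
      [MeasurableSpace T] (P : Measure Ω) [IsProbabilityMeasure P] (ν : Measure T) [SFinite ν]
      (ξ : ℕ → Ω → S) (h : (Fin m → S) → T → B), IsIID P ξ → Measurable (Function.uncurry h) →
      DegenerateKernel (P.map (ξ 0)) ν h → ∀ N : ℕ, N ≠ 0 → ∀ t : ℝ, 0 < t →
        maxTail p P ν ξ h N t ≤ K * tailBound p q (P.map (ξ 0)) ν h N t := by
  induction m with
  | zero =>
    refine ⟨q.toNNReal, fun Ω S T _ _ _ P _ ν _ ξ h hξ _ _ N _ t ht => ?_⟩
    have := hξ.isProbabilityMeasure_map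
    exact maxTail_order_zero_le hq ξ h N ht.le
  | succ m ih =>
    obtain ⟨K, hK⟩ := ih
    obtain ⟨δ, hδ0, hδ1, hδ⟩ := exists_mul_two_mul_rpow_le hφ.const_pos hp
      (show (0 : ℝ) < 2 ^ (-q) * 2⁻¹ by positivity)
    refine ⟨2 * (K * ((δ / 2) ^ (-q)).toNNReal),
      fun Ω S T _ _ _ P _ ν _ ξ h hξ hh hd N hN t ht => ?_⟩
    have := hξ.isProbabilityMeasure_map
    have hfreeze := hd.freezeLast.mono fun x hx =>
      hK Ω S T P ν ξ _ hξ (measurable_freezeLast hh x) hx N hN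
    have habsorb := hK Ω S (S × T) P _ ξ _ hξ (measurable_absorbLast hh) hd.absorbLast N hN
    push_cast
    exact le_mul_of_two_mul_le hq.le hδ (mul_nonneg hφ.const_pos.le (by positivity)) hδ0 hδ1
      (fun _ => prob_le_one)
      (fun t ht => hφ.maxTail_two_mul_le_tailBound hp hξ hh hd hN hfreeze habsorb hδ0 hδ1 ht)
      (fun c t hc hc1 => tailBound_mul_le h N hc hc1) ht

/-! ### Conditioning on some of the variables -/

lemma piecewise_univ_sdiff_singleton {S : Type*} {m : ℕ} (l : Fin m)
    (y z : Fin m → S) :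
    (Finset.univ \ {l}).piecewise y z = Function.update y l (z l) := by
  rw [← Finset.compl_eq_univ_sdiff, Finset.piecewise_compl, Finset.piecewise_singleton]

lemma setIntegral_comp_preimage {α β E : Type*} [MeasurableSpace α] [MeasurableSpace β]
    [NormedAddCommGroup E] [NormedSpace ℝ E] {μ : Measure α} {ν : Measure β} {g : α → β}
    (hg : MeasurePreserving g μ ν) {s : Set β} (hs : MeasurableSet s) {f : β → E}
    (hf : StronglyMeasurable f) : ∫ x in g ⁻¹' s, f (g x) ∂μ = ∫ y in s, f y ∂ν := by
  rw [← hg.map_eq, setIntegral_map hs hf.aestronglyMeasurable hg.measurable.aemeasurable]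

section Conditioning

variable {Ω S : Type*} [mS : MeasurableSpace S] {ξ : ℕ → Ω → S} {m : ℕ}

lemma measurable_piecewise_firstVars (J : Finset (Fin m)) :
    Measurable[(sigmaOf ξ J).prod MeasurableSpace.pi]
      fun z : Ω × (Fin m → S) => J.piecewise (firstVars m ξ z.1) z.2 := by
  refine @measurable_pi_lambda _ _ _ ((sigmaOf ξ J).prod _) _ _ fun l => ?_
  by_cases hl : l ∈ J
  · have hξl : Measurable[sigmaOf ξ J] (ξ l) :=
      (measurable_pi_apply (⟨l, hl⟩ : J)).comp
        (comap_measurable fun (ω : Ω) (j : J) => ξ (j : Fin m) ω)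
    simp only [Finset.piecewise_eq_of_mem _ _ _ hl]
    exact hξl.comp (@measurable_fst Ω (Fin m → S) (sigmaOf ξ J) _)
  · simp only [Finset.piecewise_eq_of_notMem _ _ _ hl]
    exact (measurable_pi_apply l).comp (@measurable_snd Ω (Fin m → S) (sigmaOf ξ J) _)

lemma exists_firstVars_preimage_eq {J : Finset (Fin m)} {s : Set Ω}
    (hs : MeasurableSet[sigmaOf ξ J] s) :
    ∃ E : Set (Fin m → S), MeasurableSet E ∧ firstVars m ξ ⁻¹' E = s ∧
      (fun z : Ω × (Fin m → S) => J.piecewise (firstVars m ξ z.1) z.2) ⁻¹' E = s ×ˢ Set.univ := by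
  obtain ⟨A, hA, rfl⟩ := hs
  refine ⟨{y | (fun j : J => y j) ∈ A},
    (measurable_pi_lambda _ fun j : J => measurable_pi_apply (j : Fin m)) hA, rfl, ?_⟩
  ext z
  simp [firstVars]

variable [mΩ : MeasurableSpace Ω] {P : Measure Ω}

lemma IsIID.sigmaOf_le (hξ : IsIID P ξ) (J : Finset (Fin m)) : sigmaOf ξ J ≤ mΩ :=
  (measurable_pi_iff.2 fun _ => hξ.measurable _).comap_le

variable [IsProbabilityMeasure P]

lemma IsIID.measurePreserving_firstVars (hξ : IsIID P ξ) (m : ℕ) :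
    MeasurePreserving (firstVars m ξ) P (Measure.pi fun _ => P.map (ξ 0)) :=
  hξ.measurePreserving_of_injective Fin.val_injective

lemma IsIID.measurePreserving_piecewise_firstVars (hξ : IsIID P ξ) (J : Finset (Fin m)) :
    MeasurePreserving (fun z : Ω × (Fin m → S) => J.piecewise (firstVars m ξ z.1) z.2)
      (P.prod (Measure.pi fun _ => P.map (ξ 0))) (Measure.pi fun _ => P.map (ξ 0)) :=
  have := hξ.isProbabilityMeasure_map
  (measurePreserving_piecewise J).comp
    ((hξ.measurePreserving_firstVars m).prod (MeasurePreserving.id _))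

lemma IsIID.condLExp_sigmaOf (hξ : IsIID P ξ) {F : (Fin m → S) → ℝ≥0∞} (hF : Measurable F)
    (J : Finset (Fin m)) :
    P⁻[fun ω => F (firstVars m ξ ω) | sigmaOf ξ J] =ᵐ[P]
      fun ω => ∫⁻ z, F (J.piecewise (firstVars m ξ ω) z) ∂(Measure.pi fun _ => P.map (ξ 0)) := by
  have := hξ.isProbabilityMeasure_map
  have hglue := hξ.measurePreserving_piecewise_firstVars J
  refine (ae_eq_condLExp (hξ.sigmaOf_le J) P _ ?_ fun s hs => ?_).symm
  · exact @Measurable.lintegral_prod_right' _ _ (sigmaOf ξ J) _ _ _ _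
      (hF.comp (measurable_piecewise_firstVars J))
  · obtain ⟨E, hE, hEs, hEprod⟩ := exists_firstVars_preimage_eq hs
    have hFE := hglue.setLIntegral_comp_preimage hE hF
    have hmeas : Measurable fun z : Ω × (Fin m → S) =>
        F (J.piecewise (firstVars m ξ z.1) z.2) := hF.comp hglue.measurable
    rw [hEprod, setLIntegral_prod _ hmeas.aemeasurable, Measure.restrict_univ] at hFE
    rw [hFE, ← hEs, (hξ.measurePreserving_firstVars m).setLIntegral_comp_preimage hE hF]

variable {B : Type*} [NormedAddCommGroup B] [NormedSpace ℝ B] [CompleteSpace B]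
  {h : (Fin m → S) → B}

lemma IsIID.condExp_sigmaOf (hξ : IsIID P ξ) (hh : StronglyMeasurable h)
    (hint : Integrable (fun ω => h (firstVars m ξ ω)) P) (J : Finset (Fin m)) :
    P[fun ω => h (firstVars m ξ ω) | sigmaOf ξ J] =ᵐ[P]
      fun ω => ∫ z, h (J.piecewise (firstVars m ξ ω) z) ∂(Measure.pi fun _ => P.map (ξ 0)) := by
  have := hξ.isProbabilityMeasure_map
  have hglue := hξ.measurePreserving_piecewise_firstVars J
  have hvars := hξ.measurePreserving_firstVars m
  have hint_glue : Integrable (fun z : Ω × (Fin m → S) =>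
      h (J.piecewise (firstVars m ξ z.1) z.2)) _ :=
    (hglue.integrable_comp hh.aestronglyMeasurable).2
      ((hvars.integrable_comp hh.aestronglyMeasurable).1 hint)
  refine (ae_eq_condExp_of_forall_setIntegral_eq (hξ.sigmaOf_le J) hint
    (fun s _ _ => hint_glue.integral_prod_left.integrableOn) (fun s hs _ => ?_) ?_).symm
  · obtain ⟨E, hE, hEs, hEprod⟩ := exists_firstVars_preimage_eq hs
    have hhE := setIntegral_comp_preimage hglue hE hh
    rw [hEprod, setIntegral_prod _ hint_glue.integrableOn, Measure.restrict_univ] at hhE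
    rw [hhE, ← hEs, setIntegral_comp_preimage hvars hE hh]
  · exact (@StronglyMeasurable.integral_prod_right' _ _ _ (sigmaOf ξ J) _ _ _ _ _ _
      (hh.comp_measurable (measurable_piecewise_firstVars J))).aestronglyMeasurable

lemma IsDegenerated.ae_integral_update (hd : IsDegenerated P ξ h) (hξ : IsIID P ξ)
    (hh : StronglyMeasurable h) (l : Fin m) :
    ∀ᵐ y ∂(Measure.pi fun _ => P.map (ξ 0)),
      Integrable (fun x => h (Function.update y l x)) (P.map (ξ 0)) ∧
        ∫ x, h (Function.update y l x) ∂(P.map (ξ 0)) = 0 := by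
  have := hξ.isProbabilityMeasure_map
  have hvars := hξ.measurePreserving_firstVars m
  have heval := measurePreserving_eval (fun _ : Fin m => P.map (ξ 0)) l
  have hupdate (y : Fin m → S) : StronglyMeasurable fun x => h (Function.update y l x) :=
    hh.comp_measurable (measurable_update y)
  have hintegrable : ∀ᵐ y ∂(Measure.pi fun _ => P.map (ξ 0)),
      Integrable (fun z => h ((Finset.univ \ {l}).piecewise y z))
        (Measure.pi fun _ => P.map (ξ 0)) :=
    (((measurePreserving_piecewise _).integrable_comp hh.aestronglyMeasurable).2
      ((hvars.integrable_comp hh.aestronglyMeasurable).1 hd.1)).prod_right_ae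
  have hzero : ∀ᵐ y ∂(Measure.pi fun _ => P.map (ξ 0)),
      ∫ z, h ((Finset.univ \ {l}).piecewise y z) ∂(Measure.pi fun _ => P.map (ξ 0)) = 0 := by
    have hmeas : StronglyMeasurable fun y => ∫ z, h ((Finset.univ \ {l}).piecewise y z)
        ∂(Measure.pi fun _ => P.map (ξ 0)) :=
      (hh.comp_measurable (measurable_piecewise _)).integral_prod_right'
    have hzero_vars := (hξ.condExp_sigmaOf hh hd.1 _).symm.trans (hd.2 l)
    rw [← hvars.map_eq] at hmeas ⊢
    rwa [ae_map_iff hvars.measurable.aemeasurable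
      (hmeas.measurableSet_eq_fun stronglyMeasurable_const), hvars.map_eq]
  filter_upwards [hintegrable, hzero] with y hyint hyzero
  simp only [piecewise_univ_sdiff_singleton] at hyint hyzero
  refine ⟨(heval.integrable_comp (hupdate y).aestronglyMeasurable).1 hyint, ?_⟩
  rw [← heval.map_eq, integral_map heval.measurable.aemeasurable
    (hupdate y).aestronglyMeasurable]
  exact hyzero

end Conditioning

/-! ### Kernels without a parameter -/

lemma sum_finset_eq_univ_add_filter_add_empty {ι M : Type*} [Fintype ι] [DecidableEq ι] [Nonempty ι]
    [AddCommMonoid M] (f : Finset ι → M) :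
    ∑ J, f J = f Finset.univ +
      ∑ J : Finset ι with J.Nonempty ∧ J ≠ Finset.univ, f J + f ∅ := by
  have hne : (Finset.univ : Finset ι) ≠ ∅ := Finset.univ_nonempty.ne_empty
  have hsplit : (Finset.univ : Finset (Finset ι)) = insert ∅ (insert Finset.univ
      (Finset.univ.filter fun J : Finset ι => J.Nonempty ∧ J ≠ Finset.univ)) := by
    ext J
    simp only [Finset.mem_univ, Finset.mem_insert, Finset.mem_filter, true_and, true_iff,
      Finset.nonempty_iff_ne_empty]
    tauto
  conv_lhs => rw [hsplit]
  rw [Finset.sum_insert (by simp [hne.symm]), Finset.sum_insert (by simp), add_comm]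

section ParameterFree

variable {Ω S T B : Type*} [MeasurableSpace Ω] [MeasurableSpace T] [NormedAddCommGroup B]
  {P : Measure Ω} {ξ : ℕ → Ω → S} {ν : Measure T} [IsProbabilityMeasure ν] {m : ℕ} {p q t : ℝ}

lemma measure_lt_iSup_enorm_uStat_le_maxTail (hp : 0 < p) (h : (Fin m → S) → B) (k N : ℕ) :
    P {ω | ENNReal.ofReal t < ⨆ n ∈ Finset.Icc k N, ‖uStat ξ h n ω‖ₑ} ≤
      maxTail p P ν ξ (fun y _ => h y) N t := by
  refine measure_mono fun ω hω => ?_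
  simp only [Set.mem_ofPred_eq, lt_iSup_iff] at hω
  obtain ⟨n, hn, hlt⟩ := hω
  refine ⟨n, (Finset.mem_Icc.1 hn).2, ?_⟩
  rwa [eLpNorm'_const_of_isProbabilityMeasure _ hp]

variable [MeasurableSpace S]

lemma condLpNorm_const (μ : Measure S) (h : (Fin m → S) → B) (J : Finset (Fin m))
    (y : Fin m → S) :
    condLpNorm p μ ν (fun y _ => h y) J y =
      (∫⁻ z, ‖h (J.piecewise y z)‖ₑ ^ p ∂(Measure.pi fun _ => μ)) ^ (1 / p) := by
  simp [condLpNorm]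

variable [IsProbabilityMeasure P] {h : (Fin m → S) → B}

lemma IsDegenerated.degenerateKernel [NormedSpace ℝ B] [CompleteSpace B]
    (hd : IsDegenerated P ξ h) (hξ : IsIID P ξ) (hh : StronglyMeasurable h) :
    DegenerateKernel (P.map (ξ 0)) ν (fun y _ => h y) := fun l =>
  have := hξ.isProbabilityMeasure_map
  measurePreserving_fst.quasiMeasurePreserving.ae (hd.ae_integral_update hξ hh l)

variable [MeasurableSpace B] [OpensMeasurableSpace B]

lemma IsIID.tailIntegral_condLpNorm (hξ : IsIID P ξ) (hh : Measurable h) (J : Finset (Fin m))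
    (a : ℝ≥0∞) :
    tailIntegral (Measure.pi fun _ => P.map (ξ 0))
        (fun y => a * condLpNorm p (P.map (ξ 0)) ν (fun y _ => h y) J y) q t =
      tailIntegral P (fun ω => a *
        (P⁻[fun ω' => ‖h (firstVars m ξ ω')‖ₑ ^ p | sigmaOf ξ J] ω) ^ (1 / p)) q t := by
  have := hξ.isProbabilityMeasure_map
  rw [← tailIntegral_comp (hξ.measurePreserving_firstVars m)
    ((measurable_condLpNorm (h := fun y _ => h y) (hh.comp measurable_fst) J).const_mul a)]
  refine tailIntegral_congr_ae ?_ q t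
  filter_upwards [hξ.condLExp_sigmaOf (hh.enorm.pow_const p) J] with ω hω
  rw [hω, condLpNorm_const]

lemma IsIID.tailIntegral_condLpNorm_univ (hp : p ≠ 0) (hξ : IsIID P ξ) (hh : Measurable h) :
    tailIntegral (Measure.pi fun _ => P.map (ξ 0))
        (condLpNorm p (P.map (ξ 0)) ν (fun y _ => h y) Finset.univ) q t =
      tailIntegral P (fun ω => ‖h (firstVars m ξ ω)‖ₑ) q t := by
  have := hξ.isProbabilityMeasure_map
  rw [← tailIntegral_comp (hξ.measurePreserving_firstVars m)
    (measurable_condLpNorm (h := fun y _ => h y) (hh.comp measurable_fst) _)]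
  simp [condLpNorm_const, ← ENNReal.rpow_mul, mul_inv_cancel₀ hp]

lemma IsIID.tailIntegral_condLpNorm_empty_le (hq : 0 < q) (ht : 0 < t) (hξ : IsIID P ξ)
    (hh : Measurable h) (N : ℕ) :
    tailIntegral (Measure.pi fun _ => P.map (ξ 0))
        (fun y => (N : ℝ≥0∞) ^ ((m : ℝ) / p) *
          condLpNorm p (P.map (ξ 0)) ν (fun y _ => h y) ∅ y) q t ≤
      ENNReal.ofReal (1 / q) * (ENNReal.ofReal (t ^ (-q)) * (N : ℝ≥0∞) ^ ((m : ℝ) * q / p) *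
        (∫⁻ ω, ‖h (firstVars m ξ ω)‖ₑ ^ p ∂P) ^ (q / p)) := by
  have := hξ.isProbabilityMeasure_map
  simp only [condLpNorm_const, Finset.piecewise_empty]
  refine (tailIntegral_const_le _ hq ht).trans_eq ?_
  rw [(hξ.measurePreserving_firstVars m).lintegral_comp (hh.enorm.pow_const p),
    ENNReal.mul_rpow_of_nonneg _ _ hq.le, ← ENNReal.rpow_mul, ← ENNReal.rpow_mul, mul_assoc,
    div_mul_eq_mul_div, one_div_mul_eq_div]

lemma IsIID.tailBound_le (hξ : IsIID P ξ) (hh : Measurable h) (hm : 1 ≤ m) (hp : p ≠ 0)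
    (hq : 0 < q) (ht : 0 < t) (N : ℕ) :
    tailBound p q (P.map (ξ 0)) ν (fun y _ => h y) N t ≤
      (N : ℝ≥0∞) ^ m * tailIntegral P (fun ω => ‖h (firstVars m ξ ω)‖ₑ) q t +
        ∑ J : Finset (Fin m) with J.Nonempty ∧ J ≠ Finset.univ, (N : ℝ≥0∞) ^ J.card *
          tailIntegral P (fun ω => (N : ℝ≥0∞) ^ (((m : ℝ) - (J.card : ℝ)) / p) *
            (P⁻[fun ω' => ‖h (firstVars m ξ ω')‖ₑ ^ p | sigmaOf ξ J] ω) ^ (1 / p)) q t +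
        ENNReal.ofReal (1 / q) * (ENNReal.ofReal (t ^ (-q)) * (N : ℝ≥0∞) ^ ((m : ℝ) * q / p) *
          (∫⁻ ω, ‖h (firstVars m ξ ω)‖ₑ ^ p ∂P) ^ (q / p)) := by
  have : Nonempty (Fin m) := ⟨⟨0, hm⟩⟩
  rw [tailBound, sum_finset_eq_univ_add_filter_add_empty]
  simp only [← hξ.tailIntegral_condLpNorm (ν := ν) hh]
  refine add_le_add (add_le_add (le_of_eq ?_) le_rfl) ?_
  · simp [← hξ.tailIntegral_condLpNorm_univ (ν := ν) hp hh]
  · simpa using hξ.tailIntegral_condLpNorm_empty_le hq ht hh N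

end ParameterFree

lemma mul_add_add_mul_le (K c : ℝ≥0) (x y z : ℝ≥0∞) :
    (K : ℝ≥0∞) * (x + y + c * z) ≤
      (K * (1 + c) + 1 : ℝ≥0) * x + (K * (1 + c) + 1 : ℝ≥0) * y + (K * (1 + c) + 1 : ℝ≥0) * z := by
  have hK : (K : ℝ≥0∞) ≤ (K * (1 + c) + 1 : ℝ≥0) := by
    norm_cast
    nlinarith
  have hKc : (K * c : ℝ≥0∞) ≤ (K * (1 + c) + 1 : ℝ≥0) := by
    norm_cast
    nlinarith
  rw [mul_add, mul_add, ← mul_assoc (K : ℝ≥0∞)]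
  gcongr

end

theorem mainTheorem2
    {B : Type*} [NormedAddCommGroup B] [NormedSpace ℝ B] [CompleteSpace B]
    [TopologicalSpace.SeparableSpace B] [MeasurableSpace B] [BorelSpace B]
    (m : ℕ) (hm : 1 ≤ m) (p q : ℝ) (hp : 1 < p) (hq : 0 < q) :
    ∃ K : ℝ≥0, 0 < K ∧ ∀ r : ℝ, 1 < r → r ≤ 2 → p ≤ r → IsRSmooth r B →
      ∀ {Ω S : Type*} [MeasurableSpace Ω] [MeasurableSpace S]
        (P : Measure Ω) [IsProbabilityMeasure P] (ξ : ℕ → Ω → S) (h : (Fin m → S) → B),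
        IsIID P ξ → Measurable h → IsDegenerated P ξ h →
        ∀ t : ℝ, 0 < t → ∀ N : ℕ, m ≤ N →
          P {ω | ENNReal.ofReal t < ⨆ n ∈ Finset.Icc m N, ‖uStat ξ h n ω‖ₑ} ≤
            K * (N : ℝ≥0∞) ^ m *
                tailIntegral P (fun ω => ‖h (firstVars m ξ ω)‖ₑ) q t
            + K * ∑ J : Finset (Fin m) with J.Nonempty ∧ J ≠ Finset.univ,
                (N : ℝ≥0∞) ^ J.card *
                  tailIntegral P
                    (fun ω => (N : ℝ≥0∞) ^ (((m : ℝ) - (J.card : ℝ)) / p) *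
                      (P⁻[fun ω' => ‖h (firstVars m ξ ω')‖ₑ ^ p | sigmaOf ξ J] ω) ^ (1 / p))
                    q t
            + K * ENNReal.ofReal (t ^ (-q)) * (N : ℝ≥0∞) ^ ((m : ℝ) * q / p) *
                (∫⁻ ω, ‖h (firstVars m ξ ω)‖ₑ ^ p ∂P) ^ (q / p) := by
  by_cases hsmooth : ∃ (C : ℝ) (φ : B → ℝ), IsSmoothGauge p C φ
  swap
  · exact ⟨1, one_pos, fun r _ hr2 hpr hr => absurd (hr.exists_isSmoothGauge hp.le hpr hr2) hsmooth⟩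
  obtain ⟨C, φ, hφ⟩ := hsmooth
  obtain ⟨K, hK⟩ := hφ.exists_maxTail_le hp.le hq m
  refine ⟨K * (1 + (1 / q).toNNReal) + 1, by positivity, ?_⟩
  intro r _ _ _ _ Ω S _ _ P _ ξ h hξ hh hd t ht N hmN
  have hN : N ≠ 0 := (zero_lt_one.trans_le (hm.trans hmN)).ne'
  set ν : Measure PUnit := Measure.dirac PUnit.unit
  have hkernel : DegenerateKernel (P.map (ξ 0)) ν (fun y _ => h y) :=
    hd.degenerateKernel hξ hh.stronglyMeasurable
  calc _ ≤ maxTail p P ν ξ (fun y _ => h y) N t :=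
        measure_lt_iSup_enorm_uStat_le_maxTail (by linarith) h m N
    _ ≤ K * tailBound p q (P.map (ξ 0)) ν (fun y _ => h y) N t :=
        hK Ω S PUnit P ν ξ (fun y _ => h y) hξ (hh.comp measurable_fst) hkernel N hN t ht
    _ ≤ K * _ := by
        gcongr
        exact hξ.tailBound_le hh hm (by linarith) hq ht N
    _ ≤ _ := mul_add_add_mul_le K _ _ _ _
    _ = _ := by simp only [mul_assoc]
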